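/- **Conventions.** Let $\mathbb S^n=(\mathbb R^{n+1}\smallsetminus\{0\})/\mathbb R_{>0}$, and for $U\subset\mathbb R^{n+1}$ let $\mathbb S(U)$ be the image of $U\smallsetminus\{0\}$. A *mirror polytope* in $\mathbb S^n$ with facets indexed by a finite set $S$ is given by linear forms $\alpha_s$ and vectors $b_s$ ($s\in S$) with $\alpha_s(b_s)=2$ such that $P=\bigcap_s\mathbb S(\{\alpha_s\le 0\})$ is properly convex (the image of a convex cone, with closure containing no two antipodal points) and has non-empty interior, no half-space $\mathbb S(\{\alpha_s\le0\})$ contains the intersection of the others, and for $s\ne t$ the numbers $\alpha_s(b_t),\alpha_t(b_s)$ are both negative or both zero. Its facets are $F_s=P\cap\mathbb S(\ker\alpha_s)$, its reflections are $\sigma_s=\mathrm{Id}-\alpha_s\otimes b_s$, and its Cartan matrix is $(\alpha_s(b_t))_{s,t}$. A path of mirror polytopes is one along which all $\alpha_s$ and $b_s$ vary continuously. A *projective rotation* of angle $\theta\in(0,2\pi)$ is an element of $\mathrm{SL}_{n+1}\mathbb R$ that is the identity on a subspace $H$ of codimension 2 and acts on $\mathbb R^{n+1}/H$ by a map conjugate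 to the rotation matrix of angle $\theta$; a ridge (face of codimension 2) $F_s\cap F_t$ has dihedral angle $\theta\in(0,\pi/2]$ if $\sigma_s\sigma_t$ is a projective rotation of angle $2\theta$. A real square matrix $A$ is *Cartan* if $A_{ii}=2$, $A_{ij}\le0$ for $i\neq j$, and $A_{ij}=0\Leftrightarrow A_{ji}=0$; it is *irreducible* if it is not a direct sum of smaller matrices after reordering the indices; an irreducible Cartan matrix is of *negative type* if there is $y>0$ with $Ay<0$ (in all coordinates), and $Ax\ge0$, $x\ge0$ imply $x=0$. Let $v_1,\dots,v_5\in\mathbb R^4$ be the vertices of a regular 4-simplex with barycentre $0$, let $c=|v_i|$, and for $0<s\le c$ let $Q_s$ be the set of $x\in\mathbb R^4$ with $\langle v_i,x\rangle\ge-c^2/4$ and $\langle v_i,x\rangle\le cs$ for all $i$. Let $F_i$ (opposite to $v_i$) and $F'_i$ be the faces of $Q_s$ where equality holds in the first, respectively the second inequality. $Q_s$ is a *bitruncated 4-simplex* for $c/6<s<3c/8$ and the *rectified 4-simplex* for $s=3c/8$. The *ideal hyperbolic rectified 4-simplex* $R$ is the rectified 4-simplex, viewed in the projective model of $\mathbb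 H^4$ given by the ball in which it is inscribed, with the hyperbolic reflections in its facets. Put $t_3=\frac12\bigl(11+9\sqrt2-3\sqrt{31+22\sqrt2}\bigr)$ and, for $t\in[t_3,1]$ and $p=0,1,2,3$, $$f=\frac{t(t+2)^3(2t+1)^3}{(t^2+t+1)^2(t^2+7t+1)^2},\quad h=2+\frac1t+\frac{t(t+2)^4}{(t^2+t+1)(t^2+7t+1)},\quad g_p=\frac{2t^p(t+2)^p(2t+1)^{3-p}}{(t^2+t+1)(t^2+7t+1)},\quad \overline g_p=\frac{4f}{g_p}.$$ Let $C_t$ be the matrix with rows and columns indexed by $S=\{1',\dots,5',1,\dots,5\}$, diagonal entries $2$, and off-diagonal entries $(C_t)_{i'j'}=-\overline g_{j-i-1}(t)$ for $i<j$ and $-g_{i-j-1}(t)$ for $i>j$; $(C_t)_{ij}=-1/t$ for $i<j$ and $-t$ for $i>j$; $(C_t)_{i'i}=-h(t)$, $(C_t)_{ii'}=-2$, and $(C_t)_{i'j}=(C_t)_{ij'}=0$ for $i\ne j$. **Proposition.** For every $t\in[t_3,1]$ the matrix $C_t$ is an irreducible Cartan matrix of negative type and of rank $5$, and it depends analytically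 on $t\in[t_3,1]$. There are a strictly decreasing analytic function $\alpha\colon[t_3,1]\to\mathbb R$ with $\cos^2\alpha(t)=f(t)$, $\alpha(t_3)=\pi/3$, $\alpha(1)=0$, and a path $[0,\pi/3]\ni\alpha\mapsto P_\alpha$ of mirror polytopes in $\mathbb S^4$ with facets $F'_1,\dots,F'_5,F_1,\dots,F_5$, such that $P_{\alpha(t)}$ has Cartan matrix $C_t$ for every $t\in[t_3,1]$, and: * for every $\alpha\in(0,\pi/3]$, $P_\alpha$ is combinatorially equivalent to a bitruncated 4-simplex, by an isomorphism of face posets that preserves the labels of the facets; * for every $\alpha\in(0,\pi/3]$ and all $i\ne j$, the intersections $F'_i\cap F'_j$ (the filling ridges), $F_i\cap F'_j$ and $F_i\cap F_j$ are ridges of $P_\alpha$, with dihedral angles $\alpha$, $\pi/2$ and $\pi/3$, respectively; * the limit $P_0$ is, up to a linear change of coordinates of $\mathbb R^5$, the ideal hyperbolic rectified 4-simplex $R$: its polytope, its labelled facets and its reflections are those of $R$. -/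

import Mathlib

open Set Real

noncomputable section

/-! ### The projective sphere -/

/-- The vector space `ℝⁿ⁺¹`. -/
abbrev Vec (n : ℕ) : Type := Fin (n + 1) → ℝ

/-- The projective sphere `𝕊ⁿ = (ℝⁿ⁺¹ ∖ {0}) / ℝ_{>0}`. -/
abbrev ProjSphere (n : ℕ) : Type := Module.Ray ℝ (Vec n)

/-- The canonical projection `ℝⁿ⁺¹ ∖ {0} → 𝕊ⁿ`. -/
def toSphere {n : ℕ} (v : {v : Vec n // v ≠ 0}) : ProjSphere n :=
  rayOfNeZero ℝ v.1 v.2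

/-- The projective sphere carries the quotient topology. -/
instance projSphereTopology (n : ℕ) : TopologicalSpace (ProjSphere n) :=
  TopologicalSpace.coinduced toSphere inferInstance

/-- `𝕊(U)`, the image in `𝕊ⁿ` of `U ∖ {0}`, for `U ⊆ ℝⁿ⁺¹`. -/
def sphereImage {n : ℕ} (U : Set (Vec n)) : Set (ProjSphere n) :=
  toSphere '' {v | v.1 ∈ U}

/-- The set of nonzero vectors of `ℝⁿ⁺¹` whose class lies in `A ⊆ 𝕊ⁿ`. -/
def coneOver {n : ℕ} (A : Set (ProjSphere n)) : Set (Vec n) :=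
  Subtype.val '' (toSphere ⁻¹' A)

/-- Convex subsets of `𝕊ⁿ`: the images of convex cones. -/
def IsSphereConvex {n : ℕ} (A : Set (ProjSphere n)) : Prop :=
  ∃ U : ConvexCone ℝ (Vec n), A = sphereImage (U : Set (Vec n))

/-- Properly convex subsets of `𝕊ⁿ`: convex, and the closure contains no pair of antipodal
points. -/
def IsProperlyConvex {n : ℕ} (A : Set (ProjSphere n)) : Prop :=
  IsSphereConvex A ∧ ∀ x ∈ closure A, -x ∉ closure A

/-- The closed half-space `𝕊({v | φ v ≤ 0})`. -/
def halfSphere {n : ℕ} (φ : Module.Dual ℝ (Vec n)) : Set (ProjSphere n) :=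
  sphereImage {v | φ v ≤ 0}

/-- The faces of a polytope `A ⊆ 𝕊ⁿ` (including `∅` and `A`): the intersections of `A` with
the hyperplanes `𝕊(ker φ)` such that `A` lies on one side of it. -/
def IsFace {n : ℕ} (A F : Set (ProjSphere n)) : Prop :=
  ∃ φ : Module.Dual ℝ (Vec n), A ⊆ halfSphere φ ∧ F = A ∩ sphereImage {v | φ v = 0}

/-- A ridge of an `n`-polytope is a face of codimension two: the cone over it spans a subspace
of dimension `(n + 1) - 2`. -/
def IsRidge {n : ℕ} (A F : Set (ProjSphere n)) : Prop :=
  IsFace A F ∧ Module.finrank ℝ (Submodule.span ℝ (coneOver F)) + 2 = n + 1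

/-! ### Mirror polytopes -/

/-- A mirror polytope in `𝕊ⁿ` whose facets are indexed by `S`, presented by linear forms `α_s`
and vectors `b_s`: the polytope is `⋂ₛ 𝕊({α_s ≤ 0})` and the reflections are
`σ_s = Id - α_s ⊗ b_s`. By minimality of the family of half-spaces, `S` indexes the facets of
the polytope without repetition. -/
structure MirrorPolytope (n : ℕ) (S : Type) [Finite S] where
  form : S → Module.Dual ℝ (Vec n)
  vec : S → Vec n
  form_vec : ∀ s, form s (vec s) = 2
  properlyConvex : IsProperlyConvex (⋂ s, halfSphere (form s))
  interior_nonempty : (interior (⋂ s, halfSphere (form s))).Nonempty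
  minimal : ∀ s, ¬ (⋂ t ∈ {t : S | t ≠ s}, halfSphere (form t)) ⊆ halfSphere (form s)
  neg_or_zero : ∀ s t, s ≠ t →
    (form s (vec t) < 0 ∧ form t (vec s) < 0) ∨ (form s (vec t) = 0 ∧ form t (vec s) = 0)

namespace MirrorPolytope

variable {n : ℕ} {S : Type} [Finite S]

/-- The underlying polytope. -/
def carrier (P : MirrorPolytope n S) : Set (ProjSphere n) :=
  ⋂ s, halfSphere (P.form s)

/-- The facet indexed by `s`. -/
def facet (P : MirrorPolytope n S) (s : S) : Set (ProjSphere n) :=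
  P.carrier ∩ sphereImage {v | P.form s v = 0}

theorem isFace_facet (P : MirrorPolytope n S) (s : S) : IsFace P.carrier (P.facet s) :=
  ⟨P.form s, iInter_subset _ s, rfl⟩

/-- The projective reflection `σ_s(v) = v - α_s(v) b_s`. -/
def refl (P : MirrorPolytope n S) (s : S) : Vec n ≃ₗ[ℝ] Vec n :=
  Module.reflection (P.form_vec s)

/-- The Cartan matrix `(α_s(b_t))_{s,t}`. -/
def cartan (P : MirrorPolytope n S) : Matrix S S ℝ :=
  Matrix.of fun s t => P.form s (P.vec t)

/-- Mirror polytopes are topologised by their linear forms and vectors. -/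
instance topology : TopologicalSpace (MirrorPolytope n S) :=
  TopologicalSpace.induced
    (fun P : MirrorPolytope n S => ((fun s v => P.form s v : S → Vec n → ℝ), P.vec)) inferInstance

end MirrorPolytope

/-- A projective rotation of angle `θ`: an element of `SL_{n+1}(ℝ)` that is the identity on a
subspace `H` of codimension `2` and that induces on `ℝⁿ⁺¹ / H` a map conjugate to the rotation
matrix of angle `θ`, where `0 < θ < 2π`. -/
def IsProjRotation {n : ℕ} (g : Vec n →ₗ[ℝ] Vec n) (θ : ℝ) : Prop :=
  0 < θ ∧ θ < 2 * π ∧ LinearMap.det g = 1 ∧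
    ∃ (H : Submodule ℝ (Vec n)) (hH : H ≤ H.comap g), (∀ v ∈ H, g v = v) ∧
      ∃ e : Module.Basis (Fin 2) ℝ (Vec n ⧸ H),
        LinearMap.toMatrix e e (H.mapQ H g hH) = !![cos θ, -sin θ; sin θ, cos θ]

/-- `F_s ∩ F_t` is a ridge of the mirror polytope `P`, with dihedral angle `θ`: either
`θ ∈ (0, π/2]` and `σ_s σ_t` is a projective rotation of angle `2θ`, or `θ = 0` and `σ_s σ_t`
is not a projective rotation. -/
def HasDihedralAngle {n : ℕ} {S : Type} [Finite S] (P : MirrorPolytope n S) (s t : S) (θ : ℝ) :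
    Prop :=
  IsRidge P.carrier (P.facet s ∩ P.facet t) ∧
    ((0 < θ ∧ θ ≤ π / 2 ∧
        IsProjRotation ((P.refl s : Vec n →ₗ[ℝ] Vec n) ∘ₗ (P.refl t : Vec n →ₗ[ℝ] Vec n)) (2 * θ)) ∨
      (θ = 0 ∧ ∀ η, ¬ IsProjRotation
        ((P.refl s : Vec n →ₗ[ℝ] Vec n) ∘ₗ (P.refl t : Vec n →ₗ[ℝ] Vec n)) η))

/-! ### Cartan matrices -/

/-- Cartan matrices, in the sense of Vinberg. -/
def IsCartanMatrix {S : Type} (A : Matrix S S ℝ) : Prop :=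
  (∀ i, A i i = 2) ∧ (∀ i j, i ≠ j → A i j ≤ 0) ∧ (∀ i j, i ≠ j → (A i j = 0 ↔ A j i = 0))

/-- A matrix is indecomposable if it is not, after a reordering of the indices, a direct sum of
two smaller matrices. -/
def IsIndecomposable {S : Type} (A : Matrix S S ℝ) : Prop :=
  ¬ ∃ T : Set S, T.Nonempty ∧ Tᶜ.Nonempty ∧ ∀ i ∈ T, ∀ j ∈ Tᶜ, A i j = 0 ∧ A j i = 0

/-- Negative type: there is a vector `y > 0` with `A y < 0`, and `A x ≥ 0`, `x ≥ 0` imply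
`x = 0`; here `<` and `>` are meant in every coordinate. -/
def IsNegativeType {S : Type} [Fintype S] (A : Matrix S S ℝ) : Prop :=
  (∃ y : S → ℝ, (∀ i, 0 < y i) ∧ ∀ i, A.mulVec y i < 0) ∧
    ∀ x : S → ℝ, (∀ i, 0 ≤ A.mulVec x i) → (∀ i, 0 ≤ x i) → x = 0

/-! ### The rectified and the bitruncated 4-simplex -/

/-- The index set of the facets: `Sum.inl i` stands for `F'_i`, and `Sum.inr i` for `F_i`. -/
abbrev FacetIdx : Type := Fin 5 ⊕ Fin 5

/-- Euclidean 4-space. -/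
abbrev E4 : Type := EuclideanSpace ℝ (Fin 4)

/-- `v₁, …, v₅` are the vertices of a regular 4-simplex in `ℝ⁴` with barycentre the origin. -/
def IsRegularSimplex (v : Fin 5 → E4) : Prop :=
  ∑ i, v i = 0 ∧ ∃ l : ℝ, 0 < l ∧ ∀ i j, i ≠ j → dist (v i) (v j) = l

/-- The half-spaces `H'_i` and `H_i`. The boundary of `H'_i` passes through `(s / |v_i|) v_i` and
is orthogonal to `v_i`. The boundary of `H_i` contains the vertices `v_j`, `j ≠ i`: for a regular
simplex with barycentre `0` one has `⟪v_i, v_j⟫ = -|v_i|² / 4`. -/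
def cutHalfSpace (v : Fin 5 → E4) (s : ℝ) : FacetIdx → Set E4
  | Sum.inl i => {x | inner ℝ (v i) x ≤ ‖v i‖ * s}
  | Sum.inr i => {x | -(‖v i‖ ^ 2 / 4) ≤ inner ℝ (v i) x}

/-- The boundaries of the half-spaces `H'_i` and `H_i`. -/
def cutHyperplane (v : Fin 5 → E4) (s : ℝ) : FacetIdx → Set E4
  | Sum.inl i => {x | inner ℝ (v i) x = ‖v i‖ * s}
  | Sum.inr i => {x | inner ℝ (v i) x = -(‖v i‖ ^ 2 / 4)}

/-- The polytope `Q_s = H₁ ∩ ⋯ ∩ H₅ ∩ H'₁ ∩ ⋯ ∩ H'₅`. Let `c = |v_i|`. In barycentric coordinates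
`x = ∑ λ_i v_i`, it is given by `0 ≤ λ_i ≤ (4 s / c + 1) / 5`. So it is the bitruncated 4-simplex
for `c / 6 < s < 3 c / 8` (that is, when the upper bound lies strictly between `1 / 3` and
`1 / 2`), and the rectified 4-simplex, the convex hull of the midpoints of the edges, for
`s = 3 c / 8`. -/
def cutSimplex (v : Fin 5 → E4) (s : ℝ) : Set E4 :=
  ⋂ k, cutHalfSpace v s k

/-- The facets `F'_i` and `F_i` of `Q_s`. -/
def cutFacet (v : Fin 5 → E4) (s : ℝ) (k : FacetIdx) : Set E4 :=
  cutSimplex v s ∩ cutHyperplane v s k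

/-- The mirror polytope `P` is combinatorially equivalent to `Q_s`, by an isomorphism of face
posets that matches the facets with the same labels. -/
def CombEquivCutSimplex (P : MirrorPolytope 4 FacetIdx) (v : Fin 5 → E4) (s : ℝ) : Prop :=
  ∃ e : {F : Set (ProjSphere 4) // IsFace P.carrier F} ≃o
      {B : Set E4 // IsExposed ℝ (cutSimplex v s) B},
    ∀ k, (e ⟨P.facet k, P.isFace_facet k⟩ : Set E4) = cutFacet v s k

/-- The mirror polytope `P` has the combinatorics of a bitruncated 4-simplex (for every choice of
the regular simplex and of the truncation parameter), with facets labelled accordingly. -/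
def IsCombBitruncatedSimplex (P : MirrorPolytope 4 FacetIdx) : Prop :=
  ∀ v : Fin 5 → E4, IsRegularSimplex v →
    ∀ s : ℝ, ‖v 0‖ / 6 < s → s < 3 * ‖v 0‖ / 8 → CombEquivCutSimplex P v s

/-- The bilinear form on `ℝ⁴ × ℝ` whose negative cone is the cone over the open ball
`{(x, 1) | |x| < r}`, the projective model of hyperbolic 4-space. -/
def lorentz (r : ℝ) (p q : E4 × ℝ) : ℝ :=
  inner ℝ p.1 q.1 - r ^ 2 * (p.2 * q.2)

/-- The mirror polytope `P` is the ideal hyperbolic rectified 4-simplex: in suitable linear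
coordinates `ℝ⁵ ≅ ℝ⁴ × ℝ`, its polytope is the Euclidean rectified 4-simplex placed at height `1`,
facet by facet, and its reflections are hyperbolic reflections, that is, they are isometries of the
projective model of hyperbolic space in the ball in which the rectified simplex is inscribed. -/
def IsIdealHyperbolicRectifiedSimplex (P : MirrorPolytope 4 FacetIdx) : Prop :=
  ∀ v : Fin 5 → E4, IsRegularSimplex v →
    ∃ r : ℝ, 0 < r ∧ (cutSimplex v (3 * ‖v 0‖ / 8)).extremePoints ℝ ⊆ Metric.sphere 0 r ∧
      ∃ g : Vec 4 ≃ₗ[ℝ] E4 × ℝ,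
        P.carrier = sphereImage {w | ∃ x ∈ cutSimplex v (3 * ‖v 0‖ / 8), g w = (x, 1)} ∧
        (∀ k, P.facet k = sphereImage {w | ∃ x ∈ cutFacet v (3 * ‖v 0‖ / 8) k, g w = (x, 1)}) ∧
        ∀ k w w', lorentz r (g (P.refl k w)) (g (P.refl k w')) = lorentz r (g w) (g w')

/-! ### The family of Cartan matrices -/

/-- The left end of the parameter interval. -/
def tThree : ℝ := (11 + 9 * √2 - 3 * √(31 + 22 * √2)) / 2

def fFun (t : ℝ) : ℝ :=
  t * (t + 2) ^ 3 * (2 * t + 1) ^ 3 / ((t ^ 2 + t + 1) ^ 2 * (t ^ 2 + 7 * t + 1) ^ 2)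

def hFun (t : ℝ) : ℝ :=
  2 + 1 / t + t * (t + 2) ^ 4 / ((t ^ 2 + t + 1) * (t ^ 2 + 7 * t + 1))

/-- The functions `g_p`, for `p = 0, 1, 2, 3`. -/
def gFun (p : ℕ) (t : ℝ) : ℝ :=
  2 * t ^ p * (t + 2) ^ p * (2 * t + 1) ^ (3 - p) / ((t ^ 2 + t + 1) * (t ^ 2 + 7 * t + 1))

/-- The functions `4 f / g_p`, for `p = 0, 1, 2, 3`. -/
def gBarFun (p : ℕ) (t : ℝ) : ℝ := 4 * fFun t / gFun p t

/-- The 10×10 matrix `C_t`, with rows and columns ordered `1', …, 5', 1, …, 5`. -/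
def cMatrix (t : ℝ) : Matrix FacetIdx FacetIdx ℝ :=
  Matrix.fromBlocks
    !![2, -gBarFun 0 t, -gBarFun 1 t, -gBarFun 2 t, -gBarFun 3 t;
      -gFun 0 t, 2, -gBarFun 0 t, -gBarFun 1 t, -gBarFun 2 t;
      -gFun 1 t, -gFun 0 t, 2, -gBarFun 0 t, -gBarFun 1 t;
      -gFun 2 t, -gFun 1 t, -gFun 0 t, 2, -gBarFun 0 t;
      -gFun 3 t, -gFun 2 t, -gFun 1 t, -gFun 0 t, 2]
    (Matrix.diagonal fun _ => -hFun t)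
    (Matrix.diagonal fun _ => -2)
    !![2, -(1 / t), -(1 / t), -(1 / t), -(1 / t);
      -t, 2, -(1 / t), -(1 / t), -(1 / t);
      -t, -t, 2, -(1 / t), -(1 / t);
      -t, -t, -t, 2, -(1 / t);
      -t, -t, -t, -t, 2]

end

noncomputable section

/-! ### Sets of rays -/

section Sphere

variable {n : ℕ}

theorem toSphere_surjective : Function.Surjective (toSphere (n := n)) := by
  intro x
  induction x using Module.Ray.ind with
  | h v hv => exact ⟨⟨v, hv⟩, rfl⟩

theorem toSphere_mem_sphereImage {U : Set (Vec n)} (hU : ∀ c : ℝ, 0 < c → ∀ v ∈ U, c • v ∈ U)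
    (v : {v : Vec n // v ≠ 0}) : toSphere v ∈ sphereImage U ↔ v.1 ∈ U := by
  constructor
  · rintro ⟨w, hw, h⟩
    obtain ⟨c, hc, hcv⟩ := ((ray_eq_iff w.2 v.2).1 h).exists_pos_left w.2 v.2
    rw [← hcv]
    exact hU c hc _ hw
  · exact fun h => ⟨v, h, rfl⟩

theorem toSphere_mem_halfSphere (φ : Module.Dual ℝ (Vec n)) (v : {v : Vec n // v ≠ 0}) :
    toSphere v ∈ halfSphere φ ↔ φ v.1 ≤ 0 := by
  refine toSphere_mem_sphereImage (fun c hc w hw => ?_) v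
  simpa using mul_nonpos_of_nonneg_of_nonpos hc.le hw

theorem toSphere_mem_kerImage (φ : Module.Dual ℝ (Vec n)) (v : {v : Vec n // v ≠ 0}) :
    toSphere v ∈ sphereImage {w | φ w = 0} ↔ φ v.1 = 0 :=
  toSphere_mem_sphereImage (fun c _ w hw => by simp_all) v

theorem neg_toSphere (v : {v : Vec n // v ≠ 0}) :
    -toSphere v = toSphere ⟨-v.1, neg_ne_zero.2 v.2⟩ :=
  neg_rayOfNeZero ℝ v.1 v.2

theorem isClosed_halfSphere (φ : Module.Dual ℝ (Vec n)) : IsClosed (halfSphere φ) := by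
  rw [isClosed_coinduced]
  have : toSphere ⁻¹' halfSphere φ = {v : {v : Vec n // v ≠ 0} | φ v.1 ≤ 0} := by
    ext v; exact toSphere_mem_halfSphere φ v
  rw [this]
  exact isClosed_le (φ.continuous_of_finiteDimensional.comp continuous_subtype_val)
    continuous_const

variable {S : Type} (form : S → Module.Dual ℝ (Vec n))

theorem toSphere_mem_iInter_halfSphere (v : {v : Vec n // v ≠ 0}) :
    toSphere v ∈ ⋂ s, halfSphere (form s) ↔ ∀ s, form s v.1 ≤ 0 := by
  simp [toSphere_mem_halfSphere]

theorem isProperlyConvex_iInter_halfSphere (h : ∀ v, (∀ s, form s v = 0) → v = 0) :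
    IsProperlyConvex (⋂ s, halfSphere (form s)) := by
  refine ⟨⟨⟨{v | ∀ s, form s v ≤ 0}, ?_, ?_⟩, ?_⟩, ?_⟩
  · intro c hc v hv s
    simpa using mul_nonpos_of_nonneg_of_nonpos hc.le (hv s)
  · intro v hv w hw s
    simpa using add_nonpos (hv s) (hw s)
  · ext x
    obtain ⟨v, rfl⟩ := toSphere_surjective x
    rw [toSphere_mem_iInter_halfSphere, toSphere_mem_sphereImage]
    · rfl
    · intro c hc v hv s
      simpa using mul_nonpos_of_nonneg_of_nonpos hc.le (hv s)
  · rw [(isClosed_iInter fun s => isClosed_halfSphere (form s)).closure_eq]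
    intro x hx hx'
    obtain ⟨v, rfl⟩ := toSphere_surjective x
    rw [neg_toSphere, toSphere_mem_iInter_halfSphere] at hx'
    rw [toSphere_mem_iInter_halfSphere] at hx
    refine v.2 (h v.1 fun s => le_antisymm (hx s) ?_)
    simpa using hx' s

theorem interior_iInter_halfSphere_nonempty [Finite S] [Nonempty S] {y : Vec n} (hy : ∀ s, form s y < 0) :
    (interior (⋂ s, halfSphere (form s))).Nonempty := by
  have hy0 : y ≠ 0 := by
    rintro rfl
    simpa using hy (Classical.arbitrary S)
  refine ⟨toSphere ⟨y, hy0⟩, mem_interior.2 ⟨sphereImage {v | ∀ s, form s v < 0}, ?_, ?_, ?_⟩⟩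
  · rintro _ ⟨v, hv, rfl⟩
    rw [toSphere_mem_iInter_halfSphere]
    exact fun s => (hv s).le
  · rw [isOpen_coinduced]
    have : toSphere ⁻¹' sphereImage {v : Vec n | ∀ s, form s v < 0} =
        {v : {v : Vec n // v ≠ 0} | ∀ s, form s v.1 < 0} := by
      ext v
      refine toSphere_mem_sphereImage ?_ v
      intro c hc w hw s
      simpa using mul_neg_of_pos_of_neg hc (hw s)
    rw [this, ofPred_forall]
    exact isOpen_iInter_of_finite fun s => isOpen_lt
      ((form s).continuous_of_finiteDimensional.comp continuous_subtype_val) continuous_const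
  · exact mem_image_of_mem _ (show y ∈ {v : Vec n | ∀ s, form s v < 0} from hy)

end Sphere

/-- Linear forms and vectors with the sign pattern of a Cartan matrix present a mirror polytope
as soon as the forms separate points and have a common point of strict negativity. -/
def MirrorPolytope.ofCartan {n : ℕ} {S : Type} [Finite S] [Nonempty S]
    (form : S → Module.Dual ℝ (Vec n)) (vec : S → Vec n)
    (form_vec : ∀ s, form s (vec s) = 2)
    (neg_or_zero : ∀ s t, s ≠ t →
      (form s (vec t) < 0 ∧ form t (vec s) < 0) ∨ (form s (vec t) = 0 ∧ form t (vec s) = 0))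
    (separating : ∀ v, (∀ s, form s v = 0) → v = 0)
    (exists_neg : ∃ y, ∀ s, form s y < 0) : MirrorPolytope n S where
  form := form
  vec := vec
  form_vec := form_vec
  properlyConvex := isProperlyConvex_iInter_halfSphere form separating
  interior_nonempty := interior_iInter_halfSphere_nonempty form exists_neg.choose_spec
  minimal s h := by
    have hb : vec s ≠ 0 := fun h0 => by simpa [h0] using form_vec s
    have hs : toSphere ⟨vec s, hb⟩ ∈ halfSphere (form s) := by
      refine h (mem_iInter₂.2 fun t ht => (toSphere_mem_halfSphere _ _).2 ?_)
      rcases neg_or_zero t s ht with h | h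
      · exact h.1.le
      · exact h.1.le
    have := (toSphere_mem_halfSphere _ _).1 hs
    simp only [form_vec] at this
    linarith
  neg_or_zero := neg_or_zero

theorem exists_eval_eq_and_eval_eq {V : Type*} [AddCommGroup V] [Module ℝ V]
    {φ ψ : Module.Dual ℝ V} {b c : V} (hb : φ b = 2) (hc : ψ c = 2) (hd : φ c * ψ b ≠ 4)
    (p q : ℝ) : ∃ v, φ v = p ∧ ψ v = q := by
  have hd' : 4 - φ c * ψ b ≠ 0 := sub_ne_zero.2 (Ne.symm hd)
  refine ⟨((2 * p - φ c * q) / (4 - φ c * ψ b)) • b +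
    ((2 * q - ψ b * p) / (4 - φ c * ψ b)) • c, ?_, ?_⟩
  all_goals
    simp only [map_add, map_smul, smul_eq_mul, hb, hc]
    field_simp
    ring

/-! ### Small perturbations of finitely many strict inequalities -/

theorem exists_pos_forall_add_mul_nonpos {κ : Type*} [Finite κ] (a b : κ → ℝ)
    (ha : ∀ k, a k ≤ 0) (hb : ∀ k, a k = 0 → b k ≤ 0) :
    ∃ ε : ℝ, 0 < ε ∧ ∀ k, a k + ε * b k ≤ 0 := by
  have key : ∀ k, ∀ᶠ ε in nhdsWithin (0 : ℝ) (Ioi 0), a k + ε * b k ≤ 0 := by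
    intro k
    rcases (ha k).lt_or_eq with h | h
    · have hc : Filter.Tendsto (fun ε : ℝ => a k + ε * b k) (nhdsWithin 0 (Ioi 0))
          (nhds (a k)) := by
        have : Continuous (fun ε : ℝ => a k + ε * b k) := by fun_prop
        simpa using (this.tendsto 0).mono_left nhdsWithin_le_nhds
      filter_upwards [hc.eventually_lt_const h] with ε hε using hε.le
    · filter_upwards [self_mem_nhdsWithin] with ε hε
      rw [h, zero_add]
      exact mul_nonpos_of_nonneg_of_nonpos (le_of_lt hε) (hb k h)
  obtain ⟨ε, hε, h⟩ := ((Filter.eventually_all.2 key).and self_mem_nhdsWithin).exists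
  exact ⟨ε, h, hε⟩

/-! ### Face posets and active sets -/

/-- The faces of a polytope whose points have active sets `act x`: the empty set, and the sets of
points at which all constraints active at some given point are active. -/
def IsActiveFace {X κ : Type*} (A : Set X) (act : X → Set κ) (F : Set X) : Prop :=
  F = ∅ ∨ ∃ x₀ ∈ A, F = {x ∈ A | act x₀ ⊆ act x}

section ActiveFace

variable {X Y κ : Type*} {A : Set X} {B : Set Y} {actA : X → Set κ} {actB : Y → Set κ}

/-- The points of `B` that have the same active set as some point of `F`. -/
def transferFace (actA : X → Set κ) (B : Set Y) (actB : Y → Set κ) (F : Set X) : Set Y :=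
  {y ∈ B | ∃ x ∈ F, actA x = actB y}

theorem transferFace_setOf (h : actA '' A = actB '' B) (p : Set κ → Prop) :
    transferFace actA B actB {x ∈ A | p (actA x)} = {y ∈ B | p (actB y)} := by
  ext y
  constructor
  · rintro ⟨hy, x, ⟨_, hx⟩, e⟩
    exact ⟨hy, e ▸ hx⟩
  · rintro ⟨hy, hp⟩
    obtain ⟨x, hx, e⟩ : actB y ∈ actA '' A := h ▸ mem_image_of_mem _ hy
    exact ⟨hy, x, ⟨hx, e ▸ hp⟩, e⟩

theorem IsActiveFace.transferFace (h : actA '' A = actB '' B) {F : Set X}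
    (hF : IsActiveFace A actA F) : IsActiveFace B actB (transferFace actA B actB F) := by
  rcases hF with rfl | ⟨x₀, hx₀, rfl⟩
  · left; ext; simp [_root_.transferFace]
  · obtain ⟨y₀, hy₀, e⟩ : actA x₀ ∈ actB '' B := h ▸ mem_image_of_mem _ hx₀
    exact Or.inr ⟨y₀, hy₀, by rw [transferFace_setOf h (fun J => actA x₀ ⊆ J), e]⟩

theorem IsActiveFace.exists_setOf {F : Set X} (hF : IsActiveFace A actA F) :
    ∃ p : Set κ → Prop, F = {x ∈ A | p (actA x)} := by
  rcases hF with rfl | ⟨x₀, _, rfl⟩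
  · exact ⟨fun _ => False, by simp⟩
  · exact ⟨fun J => actA x₀ ⊆ J, rfl⟩

theorem transferFace_transferFace (h : actA '' A = actB '' B) {F : Set X}
    (hF : IsActiveFace A actA F) :
    transferFace actB A actA (transferFace actA B actB F) = F := by
  obtain ⟨p, rfl⟩ := hF.exists_setOf
  rw [transferFace_setOf h, transferFace_setOf h.symm]

theorem transferFace_mono {F G : Set X} (h : F ⊆ G) :
    transferFace actA B actB F ⊆ transferFace actA B actB G :=
  fun _ ⟨hy, x, hx, e⟩ => ⟨hy, x, h hx, e⟩

/-- Polytopes with the same active sets have isomorphic face posets. -/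
def activeFaceOrderIso (h : actA '' A = actB '' B) {PA : Set X → Prop} {PB : Set Y → Prop}
    (hA : ∀ F, PA F ↔ IsActiveFace A actA F) (hB : ∀ F, PB F ↔ IsActiveFace B actB F) :
    {F : Set X // PA F} ≃o {F : Set Y // PB F} where
  toFun F := ⟨transferFace actA B actB F.1, (hB _).2 (((hA _).1 F.2).transferFace h)⟩
  invFun F := ⟨transferFace actB A actA F.1, (hA _).2 (((hB _).1 F.2).transferFace h.symm)⟩
  left_inv F := Subtype.ext (transferFace_transferFace h ((hA _).1 F.2))
  right_inv F := Subtype.ext (transferFace_transferFace h.symm ((hB _).1 F.2))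
  map_rel_iff' {F G} := by
    refine ⟨fun hle => ?_, fun hle => transferFace_mono hle⟩
    have := transferFace_mono (actA := actB) (B := A) (actB := actA)
      (show transferFace actA B actB F.1 ⊆ transferFace actA B actB G.1 from hle)
    rwa [transferFace_transferFace h ((hA _).1 F.2),
      transferFace_transferFace h ((hA _).1 G.2)] at this

end ActiveFace

/-- In a nonempty family closed under some operation intersecting active sets, there is a point
with least active set. -/
theorem exists_forall_act_subset {X κ : Type*} [Finite κ] {F : Set X} (act : X → Set κ)
    (hF : F.Nonempty) (h : ∀ x ∈ F, ∀ y ∈ F, ∃ z ∈ F, act z ⊆ act x ∩ act y) :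
    ∃ x₀ ∈ F, ∀ x ∈ F, act x₀ ⊆ act x := by
  obtain ⟨J, ⟨x₀, hx₀, rfl⟩, hmin⟩ :=
    (Set.toFinite (act '' F)).exists_minimal (hF.image act)
  refine ⟨x₀, hx₀, fun x hx => ?_⟩
  obtain ⟨z, hz, hzs⟩ := h x₀ hx₀ x hx
  exact (hmin (mem_image_of_mem _ hz) (hzs.trans inter_subset_left)).trans
    (hzs.trans inter_subset_right)

/-! ### Faces of mirror polytopes -/

namespace MirrorPolytope

variable {n : ℕ} {S : Type} [Finite S] (P : MirrorPolytope n S)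

/-- The facets through a given point. -/
def act (x : ProjSphere n) : Set S := {s | x ∈ sphereImage {v | P.form s v = 0}}

theorem mem_act {v : {v : Vec n // v ≠ 0}} {s : S} :
    s ∈ P.act (toSphere v) ↔ P.form s v.1 = 0 :=
  toSphere_mem_kerImage _ v

theorem mem_carrier {v : {v : Vec n // v ≠ 0}} :
    toSphere v ∈ P.carrier ↔ ∀ s, P.form s v.1 ≤ 0 :=
  toSphere_mem_iInter_halfSphere _ v

theorem facet_eq (s : S) : P.facet s = {x ∈ P.carrier | s ∈ P.act x} := rfl

theorem eq_zero_of_nonpos_of_nonneg {v : Vec n} (h : ∀ s, P.form s v ≤ 0)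
    (h' : ∀ s, 0 ≤ P.form s v) : v = 0 := by
  by_contra hv
  have h1 := subset_closure (P.mem_carrier (v := ⟨v, hv⟩) |>.2 h)
  refine P.properlyConvex.2 _ h1 (subset_closure ?_)
  rw [neg_toSphere]
  exact P.mem_carrier.2 fun s => by simpa using h' s

theorem isFace_iff (F : Set (ProjSphere n)) :
    IsFace P.carrier F ↔ IsActiveFace P.carrier P.act F := by
  have := Fintype.ofFinite S
  constructor
  · rintro ⟨φ, hφ, rfl⟩
    rcases (P.carrier ∩ sphereImage {v | φ v = 0}).eq_empty_or_nonempty with h | h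
    · exact Or.inl h
    right
    obtain ⟨x₀, hx₀, hmin⟩ := exists_forall_act_subset P.act h (by
      rintro x ⟨hx, hx0⟩ y ⟨hy, hy0⟩
      obtain ⟨v, rfl⟩ := toSphere_surjective x
      obtain ⟨w, rfl⟩ := toSphere_surjective y
      rw [mem_carrier] at hx hy
      rw [toSphere_mem_kerImage] at hx0 hy0
      have hne : v.1 + w.1 ≠ 0 := by
        intro h0
        refine v.2 (P.eq_zero_of_nonpos_of_nonneg hx fun s => ?_)
        have := hy s
        rw [eq_neg_of_add_eq_zero_left h0, map_neg]
        linarith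
      refine ⟨toSphere ⟨_, hne⟩, ⟨P.mem_carrier.2 fun s => ?_, ?_⟩, fun s hs => ?_⟩
      · simpa using add_nonpos (hx s) (hy s)
      · rw [toSphere_mem_kerImage]
        simp [hx0, hy0]
      · rw [mem_act, map_add] at hs
        rw [mem_inter_iff, mem_act, mem_act]
        have := hx s
        have := hy s
        exact ⟨by linarith, by linarith⟩)
    refine ⟨x₀, hx₀.1, Subset.antisymm (fun x hx => ⟨hx.1, hmin x hx⟩) ?_⟩
    rintro x ⟨hx, hsub⟩
    refine ⟨hx, ?_⟩
    obtain ⟨hx₀, hx₀0⟩ := hx₀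
    obtain ⟨v, rfl⟩ := toSphere_surjective x
    obtain ⟨w, rfl⟩ := toSphere_surjective x₀
    have hvφ := (toSphere_mem_halfSphere _ _).1 (hφ hx)
    rw [mem_carrier] at hx hx₀
    rw [toSphere_mem_kerImage] at hx₀0 ⊢
    obtain ⟨ε, hε, hle⟩ := exists_pos_forall_add_mul_nonpos (fun s => P.form s w.1)
      (fun s => -P.form s v.1) hx₀ (fun s hs => by
        have : s ∈ P.act (toSphere v) := hsub (P.mem_act.2 hs)
        rw [mem_act] at this
        simp [this])
    by_cases h0 : w.1 - ε • v.1 = 0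
    · have h1 : φ w.1 = ε * φ v.1 := by rw [sub_eq_zero.1 h0]; simp
      rw [hx₀0] at h1
      exact (mul_eq_zero.1 h1.symm).resolve_left hε.ne'
    · have h1 : toSphere ⟨_, h0⟩ ∈ P.carrier := by
        rw [mem_carrier]
        intro s
        have := hle s
        simp only [map_sub, map_smul, smul_eq_mul]
        linarith
      have h2 := (toSphere_mem_halfSphere _ _).1 (hφ h1)
      simp only [map_sub, map_smul, smul_eq_mul, hx₀0] at h2
      exact le_antisymm hvφ (by nlinarith)
  · rintro (rfl | ⟨x₀, hx₀, rfl⟩)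
    · refine ⟨∑ s, P.form s, ?_, ?_⟩
      · intro x hx
        obtain ⟨v, rfl⟩ := toSphere_surjective x
        rw [mem_carrier] at hx
        rw [toSphere_mem_halfSphere, LinearMap.sum_apply]
        exact Finset.sum_nonpos fun s _ => hx s
      · symm
        rw [← disjoint_iff_inter_eq_empty, disjoint_left]
        intro x hx hx0
        obtain ⟨v, rfl⟩ := toSphere_surjective x
        rw [mem_carrier] at hx
        rw [toSphere_mem_kerImage, LinearMap.sum_apply,
          Finset.sum_eq_zero_iff_of_nonpos fun s _ => hx s] at hx0
        exact v.2 (P.eq_zero_of_nonpos_of_nonneg hx fun s => (hx0 s (Finset.mem_univ s)).ge)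
    · classical
      refine ⟨∑ s with s ∈ P.act x₀, P.form s, ?_, ?_⟩
      · intro x hx
        obtain ⟨v, rfl⟩ := toSphere_surjective x
        rw [mem_carrier] at hx
        rw [toSphere_mem_halfSphere, LinearMap.sum_apply]
        exact Finset.sum_nonpos fun s _ => hx s
      · ext x
        obtain ⟨v, rfl⟩ := toSphere_surjective x
        refine and_congr_right fun hx => ?_
        rw [mem_carrier] at hx
        rw [toSphere_mem_kerImage, LinearMap.sum_apply,
          Finset.sum_eq_zero_iff_of_nonpos fun s _ => hx s]
        simp only [Finset.mem_filter, Finset.mem_univ, true_and, subset_def, mem_act]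

/-- If some point of `P` lies on exactly the facets `s` and `t`, and the forms of these are
independent, then these facets meet in a ridge. -/
theorem isRidge_facet_inter {s t : S} {y : Vec n} (hy0 : y ≠ 0)
    (hs : P.form s y = 0) (ht : P.form t y = 0)
    (hy : ∀ u, u ≠ s → u ≠ t → P.form u y < 0)
    (hdet : P.form s (P.vec t) * P.form t (P.vec s) ≠ 4) :
    IsRidge P.carrier (P.facet s ∩ P.facet t) := by
  have hyc : ∀ u, P.form u y ≤ 0 := fun u => by
    by_cases h1 : u = s
    · rw [h1, hs]
    by_cases h2 : u = t
    · rw [h2, ht]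
    exact (hy u h1 h2).le
  constructor
  · rw [isFace_iff]
    refine Or.inr ⟨toSphere ⟨y, hy0⟩, P.mem_carrier.2 hyc, ?_⟩
    ext x
    constructor
    · rintro ⟨⟨hx, hxs⟩, -, hxt⟩
      refine ⟨hx, fun u hu => ?_⟩
      rw [mem_act] at hu
      by_cases h1 : u = s
      · rw [h1]; exact hxs
      by_cases h2 : u = t
      · rw [h2]; exact hxt
      exact absurd hu (hy u h1 h2).ne
    · rintro ⟨hx, hsub⟩
      exact ⟨⟨hx, hsub (P.mem_act.2 hs)⟩, hx, hsub (P.mem_act.2 ht)⟩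
  · let L : Vec n →ₗ[ℝ] ℝ × ℝ := (P.form s).prod (P.form t)
    have hspan : Submodule.span ℝ (coneOver (P.facet s ∩ P.facet t)) = LinearMap.ker L := by
      have hmem : ∀ v : Vec n, v ≠ 0 → (v ∈ coneOver (P.facet s ∩ P.facet t) ↔
          (∀ u, P.form u v ≤ 0) ∧ P.form s v = 0 ∧ P.form t v = 0) := by
        intro v hv
        constructor
        · rintro ⟨w, ⟨⟨hc, h1⟩, _, h2⟩, rfl⟩
          exact ⟨P.mem_carrier.1 hc, (toSphere_mem_kerImage _ _).1 h1,
            (toSphere_mem_kerImage _ _).1 h2⟩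
        · rintro ⟨hc, h1, h2⟩
          exact ⟨⟨v, hv⟩, ⟨⟨P.mem_carrier.2 hc, (toSphere_mem_kerImage _ _).2 h1⟩,
            P.mem_carrier.2 hc, (toSphere_mem_kerImage _ _).2 h2⟩, rfl⟩
      apply le_antisymm
      · rw [Submodule.span_le]
        intro v hv
        have hv0 : v ≠ 0 := by obtain ⟨w, _, rfl⟩ := hv; exact w.2
        have := (hmem v hv0).1 hv
        simp [L, this.2]
      · intro v hv
        obtain ⟨hvs, hvt⟩ : P.form s v = 0 ∧ P.form t v = 0 := by simpa [L] using hv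
        obtain ⟨ε, hε, hle⟩ := exists_pos_forall_add_mul_nonpos (fun u => P.form u y)
          (fun u => P.form u v) hyc (fun u hu => by
            by_cases h1 : u = s
            · simp [h1, hvs]
            by_cases h2 : u = t
            · simp [h2, hvt]
            exact absurd hu (hy u h1 h2).ne)
        have hyS := Submodule.subset_span (R := ℝ) ((hmem y hy0).2 ⟨hyc, hs, ht⟩)
        have hzS : y + ε • v ∈ Submodule.span ℝ (coneOver (P.facet s ∩ P.facet t)) := by
          by_cases h0 : y + ε • v = 0
          · rw [h0]; exact Submodule.zero_mem _
          · refine Submodule.subset_span ((hmem _ h0).2 ⟨fun u => ?_, ?_, ?_⟩)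
            · simpa using hle u
            · simp [hs, hvs]
            · simp [ht, hvt]
        have : v = ε⁻¹ • ((y + ε • v) - y) := by
          rw [add_sub_cancel_left, smul_smul, inv_mul_cancel₀ hε.ne', one_smul]
        rw [this]
        exact Submodule.smul_mem _ _ (Submodule.sub_mem _ hzS hyS)
    have hsurj : LinearMap.range L = ⊤ := by
      rw [LinearMap.range_eq_top]
      rintro ⟨p, q⟩
      obtain ⟨v, hp, hq⟩ := exists_eval_eq_and_eval_eq (P.form_vec s) (P.form_vec t) hdet p q
      exact ⟨v, Prod.ext hp hq⟩
    have h1 := L.finrank_range_add_finrank_ker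
    rw [hsurj] at h1
    rw [hspan]
    simp at h1
    omega

end MirrorPolytope

/-! ### Products of two reflections -/

theorem det_reflection {n : ℕ} {φ : Module.Dual ℝ (Vec n)} {b : Vec n} (hb : φ b = 2) :
    LinearMap.det (Module.reflection hb : Vec n →ₗ[ℝ] Vec n) = -1 := by
  have : (Module.reflection hb : Vec n →ₗ[ℝ] Vec n) = LinearMap.transvection φ (-b) := by
    refine LinearMap.ext fun v => ?_
    rw [LinearMap.transvection.apply, smul_neg, ← sub_eq_add_neg]
    exact Module.reflection_apply v hb
  rw [this, LinearMap.transvection.det, map_neg, hb]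
  norm_num

theorem isProjRotation_reflection_comp {n : ℕ} {φ ψ : Module.Dual ℝ (Vec n)} {b c : Vec n}
    (hb : φ b = 2) (hc : ψ c = 2) (h0 : φ c = 0 ↔ ψ b = 0) {θ : ℝ} (hθ : 0 < θ)
    (hθ' : θ ≤ π / 2) (h : φ c * ψ b = 4 * cos θ ^ 2) :
    IsProjRotation ((Module.reflection hb : Vec n →ₗ[ℝ] Vec n) ∘ₗ
      (Module.reflection hc : Vec n →ₗ[ℝ] Vec n)) (2 * θ) := by
  have hpi := Real.pi_pos
  have hsin : 0 < sin θ := sin_pos_of_pos_of_lt_pi hθ (by linarith)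
  have hsq := sin_sq_add_cos_sq θ
  refine ⟨by linarith, by linarith, ?_, ?_⟩
  · rw [LinearMap.det_comp, det_reflection, det_reflection]
    norm_num
  set p := φ c with hp
  set q := ψ b with hq
  have hC : cos (2 * θ) = p * q / 2 - 1 := by rw [cos_two_mul, h]; ring
  have hS : sin (2 * θ) ^ 2 = 1 - cos (2 * θ) ^ 2 := by
    rw [← sin_sq_add_cos_sq (2 * θ)]; ring
  obtain ⟨k, hk0, hk1, hk2⟩ : ∃ k : ℝ, k ≠ 0 ∧ k * q = -sin (2 * θ) ∧
      -sin (2 * θ) * k = p * (1 - p * q / 4) := by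
    by_cases hq0 : q = 0
    · have hp0 := h0.2 hq0
      have hcos : cos θ = 0 := by
        rw [hq0, mul_zero] at h
        exact pow_eq_zero_iff (two_ne_zero) |>.1 (by linarith)
      refine ⟨1, one_ne_zero, ?_, ?_⟩ <;> simp [hq0, hp0, sin_two_mul, hcos]
    · have hp0 : p ≠ 0 := fun h' => hq0 (h0.1 h')
      have hcos : cos θ ≠ 0 := by
        intro h'
        rw [h'] at h
        exact mul_ne_zero hp0 hq0 (by simpa using h)
      refine ⟨-sin (2 * θ) / q, ?_, by field_simp, ?_⟩
      · rw [sin_two_mul]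
        exact div_ne_zero (neg_ne_zero.2 (mul_ne_zero (mul_ne_zero two_ne_zero hsin.ne') hcos)) hq0
      · rw [← mul_div_assoc, neg_mul_neg, ← sq, hS, hC]
        field_simp
        ring
  have hd : p * q ≠ 4 := by rw [h]; nlinarith
  set g : Vec n →ₗ[ℝ] Vec n := (Module.reflection hb : Vec n →ₗ[ℝ] Vec n) ∘ₗ
    (Module.reflection hc : Vec n →ₗ[ℝ] Vec n) with hg
  have hgv : ∀ v, g v = v - ψ v • c - (φ v - ψ v * p) • b := by
    intro v
    simp [hg, Module.reflection_apply, ← hp]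
  have hφg : ∀ v, φ (g v) = -φ v + p * ψ v := by
    intro v
    rw [hgv]
    simp only [map_sub, map_smul, smul_eq_mul, hb, ← hp]
    ring
  have hψg : ∀ v, ψ (g v) = -q * φ v + (p * q - 1) * ψ v := by
    intro v
    rw [hgv]
    simp only [map_sub, map_smul, smul_eq_mul, hc, ← hq]
    ring
  let L : Vec n →ₗ[ℝ] (Fin 2 → ℝ) := LinearMap.pi ![φ - (p / 2) • ψ, k • ψ]
  have hL : ∀ v, L v = ![φ v - p / 2 * ψ v, k * ψ v] := by
    intro v
    ext i
    fin_cases i <;> simp [L]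
  have hLsurj : Function.Surjective L := by
    intro x
    obtain ⟨v, h1, h2⟩ := exists_eval_eq_and_eval_eq hb hc hd (x 0 + p / 2 * (x 1 / k)) (x 1 / k)
    refine ⟨v, ?_⟩
    rw [hL, h1, h2]
    ext i
    fin_cases i
    · simp
    · simp [mul_div_cancel₀ _ hk0]
  have hLg : ∀ v, L (g v) =
      !![cos (2 * θ), -sin (2 * θ); sin (2 * θ), cos (2 * θ)].mulVec (L v) := by
    intro v
    simp only [hL, hφg, hψg]
    ext i
    fin_cases i
    · simp [Matrix.mulVec, dotProduct, Fin.sum_univ_two]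
      rw [hC]
      linear_combination (-ψ v) * hk2
    · simp [Matrix.mulVec, dotProduct, Fin.sum_univ_two]
      rw [hC]
      linear_combination (-φ v + p / 2 * ψ v) * hk1
  refine ⟨LinearMap.ker L, fun v hv => ?_, fun v hv => ?_, ?_⟩
  · rw [Submodule.mem_comap, LinearMap.mem_ker, hLg, LinearMap.mem_ker.1 hv, Matrix.mulVec_zero]
  · have h1 : L v = 0 := hv
    rw [hL] at h1
    have h2 : ψ v = 0 := by simpa [hk0] using congrFun h1 1
    have h3 : φ v = 0 := by simpa [h2] using congrFun h1 0
    rw [hgv, h2, h3]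
    simp
  · refine ⟨Module.Basis.ofEquivFun (L.quotKerEquivOfSurjective hLsurj), ?_⟩
    ext i j
    rw [LinearMap.toMatrix_apply]
    set e := L.quotKerEquivOfSurjective hLsurj with he
    obtain ⟨v, hv⟩ := Submodule.Quotient.mk_surjective _ ((Module.Basis.ofEquivFun e) j)
    have h1 : L v = Pi.single j 1 := by
      have : e (Submodule.Quotient.mk v) = L v := rfl
      rw [← this, hv, Module.Basis.coe_ofEquivFun]
      simp
    rw [← hv]
    change L (g v) i = _
    rw [hLg, h1]
    simp

/-! ### Cones cut out of an orthant by a matrix with negative principal minors of order three -/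

/-- A matrix with diagonal entries `2` and negative off-diagonal entries whose principal minors of
order two are nonnegative and whose principal minors of order three are negative. -/
structure IsTripleNegative {ι : Type*} (M : Matrix ι ι ℝ) : Prop where
  diag : ∀ i, M i i = 2
  neg : ∀ i j, i ≠ j → M i j < 0
  mul_le : ∀ i j, i ≠ j → M i j * M j i ≤ 4
  minor_neg : ∀ i j k, i ≠ j → i ≠ k → j ≠ k →
    8 - 2 * (M i j * M j i + M j k * M k j + M i k * M k i) +
      M i j * M j k * M k i + M i k * M k j * M j i < 0

/-- The forms defining the cone `{x ≥ 0, M x ≤ 0}`. -/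
def cutForm {ι : Type*} [Fintype ι] (M : Matrix ι ι ℝ) : ι ⊕ ι → Module.Dual ℝ (ι → ℝ) :=
  Sum.elim (fun i => (1 / 2 : ℝ) • (LinearMap.proj i ∘ₗ M.mulVecLin)) (fun i => -LinearMap.proj i)

section Cut

variable {ι : Type*} {M : Matrix ι ι ℝ}

section Forms

variable [Fintype ι]

@[simp] theorem cutForm_inl (i : ι) (y : ι → ℝ) :
    cutForm M (Sum.inl i) y = 1 / 2 * M.mulVec y i := by
  simp [cutForm]

@[simp] theorem cutForm_inr (i : ι) (y : ι → ℝ) : cutForm M (Sum.inr i) y = -y i := by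
  simp [cutForm]

end Forms

/-- If every constraint outside `J` is inactive at some point of a cone at which the constraints
in `J` are active, then some point of the cone has active set exactly `J`. -/
theorem exists_active_eq {κ V : Type*} [Finite κ] [AddCommGroup V] [Module ℝ V]
    (ℓ : κ → Module.Dual ℝ V) (J : Set κ)
    (h : ∀ p ∉ J, ∃ y, (∀ q, ℓ q y ≤ 0) ∧ (∀ q ∈ J, ℓ q y = 0) ∧ ℓ p y < 0) :
    ∃ y, (∀ q ∈ J, ℓ q y = 0) ∧ ∀ q ∉ J, ℓ q y < 0 := by
  classical
  have := Fintype.ofFinite κ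
  choose! y hle heq hlt using h
  refine ⟨∑ p with p ∉ J, y p, fun q hq => ?_, fun q hq => ?_⟩
  · rw [map_sum]
    exact Finset.sum_eq_zero fun p hp => heq p (Finset.mem_filter.1 hp).2 q hq
  · rw [map_sum]
    exact Finset.sum_neg' (fun p hp => hle p (Finset.mem_filter.1 hp).2 q)
      ⟨q, by simpa using hq, hlt q hq⟩

theorem IsTripleNegative.transpose (hM : IsTripleNegative M) :
    IsTripleNegative M.transpose where
  diag i := hM.diag i
  neg i j h := hM.neg j i h.symm
  mul_le i j h := hM.mul_le j i h.symm
  minor_neg i j k hij hik hjk := by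
    have := hM.minor_neg i j k hij hik hjk
    simp only [Matrix.transpose_apply]
    linarith

variable [DecidableEq ι]

/-- The ray spanned by `i`, `j`, `k` on which the constraints `M x i ≤ 0`, `M x j ≤ 0` are active. -/
def cutVertex (M : Matrix ι ι ℝ) (i j k : ι) : ι → ℝ :=
  Pi.single i (M i j * M j k - 2 * M i k) + Pi.single j (M j i * M i k - 2 * M j k) +
    Pi.single k (4 - M i j * M j i)

theorem mulVec_cutVertex [Fintype ι] (i j k l : ι) :
    M.mulVec (cutVertex M i j k) l = M l i * (M i j * M j k - 2 * M i k) +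
      M l j * (M j i * M i k - 2 * M j k) + M l k * (4 - M i j * M j i) := by
  simp [cutVertex, Matrix.mulVec_add, Matrix.mulVec_single]

namespace IsTripleNegative

variable {i j k l : ι}

theorem cutVertex_left_pos (hM : IsTripleNegative M) (hij : i ≠ j) (hik : i ≠ k) (hjk : j ≠ k) :
    0 < cutVertex M i j k i := by
  have h1 := mul_pos_of_neg_of_neg (hM.neg i j hij) (hM.neg j k hjk)
  have h2 := hM.neg i k hik
  simp [cutVertex, hij, hik]
  linarith

theorem cutVertex_mid_pos (hM : IsTripleNegative M) (hij : i ≠ j) (hik : i ≠ k) (hjk : j ≠ k) :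
    0 < cutVertex M i j k j := by
  have h1 := mul_pos_of_neg_of_neg (hM.neg j i hij.symm) (hM.neg i k hik)
  have h2 := hM.neg j k hjk
  simp [cutVertex, hij.symm, hjk]
  linarith

theorem cutVertex_right (hik : i ≠ k) (hjk : j ≠ k) : cutVertex M i j k k = 4 - M i j * M j i := by
  simp [cutVertex, hik.symm, hjk.symm]

theorem cutVertex_of_ne (hli : l ≠ i) (hlj : l ≠ j) (hlk : l ≠ k) : cutVertex M i j k l = 0 := by
  simp [cutVertex, hli, hlj, hlk]

theorem cutVertex_nonneg (hM : IsTripleNegative M)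
    (hij : i ≠ j) (hik : i ≠ k) (hjk : j ≠ k) (l : ι) :
    0 ≤ cutVertex M i j k l := by
  by_cases hli : l = i
  · rw [hli]; exact (hM.cutVertex_left_pos hij hik hjk).le
  by_cases hlj : l = j
  · rw [hlj]; exact (hM.cutVertex_mid_pos hij hik hjk).le
  by_cases hlk : l = k
  · rw [hlk, cutVertex_right hik hjk]
    linarith [hM.mul_le i j hij]
  exact (cutVertex_of_ne hli hlj hlk).ge

theorem mulVec_cutVertex_left [Fintype ι] (hM : IsTripleNegative M) :
    M.mulVec (cutVertex M i j k) i = 0 := by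
  rw [mulVec_cutVertex, hM.diag]; ring

theorem mulVec_cutVertex_mid [Fintype ι] (hM : IsTripleNegative M) :
    M.mulVec (cutVertex M i j k) j = 0 := by
  rw [mulVec_cutVertex, hM.diag]; ring

theorem mulVec_cutVertex_neg [Fintype ι] (hM : IsTripleNegative M)
    (hij : i ≠ j) (hik : i ≠ k) (hjk : j ≠ k) (hli : l ≠ i) (hlj : l ≠ j) :
    M.mulVec (cutVertex M i j k) l < 0 := by
  by_cases hlk : l = k
  · subst hlk
    have := hM.minor_neg i j l hij hik hjk
    rw [mulVec_cutVertex, hM.diag]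
    linarith
  have h1 := hM.cutVertex_left_pos hij hik hjk
  have h2 := hM.cutVertex_mid_pos hij hik hjk
  have h3 := hM.cutVertex_nonneg hij hik hjk k
  simp only [Matrix.mulVec, dotProduct]
  refine Finset.sum_neg' (fun m _ => ?_) ⟨i, Finset.mem_univ i, ?_⟩
  · by_cases hml : m = l
    · rw [hml, cutVertex_of_ne hli hlj hlk, mul_zero]
    · exact mul_nonpos_of_nonpos_of_nonneg (hM.neg l m (Ne.symm hml)).le
        (hM.cutVertex_nonneg hij hik hjk m)
  · exact mul_neg_of_neg_of_pos (hM.neg l i hli) h1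

theorem cutForm_cutVertex_nonpos [Fintype ι] (hM : IsTripleNegative M)
    (hij : i ≠ j) (hik : i ≠ k) (hjk : j ≠ k) (q : ι ⊕ ι) :
    cutForm M q (cutVertex M i j k) ≤ 0 := by
  rcases q with l | l
  · rw [cutForm_inl]
    by_cases hli : l = i
    · rw [hli, hM.mulVec_cutVertex_left, mul_zero]
    by_cases hlj : l = j
    · rw [hlj, hM.mulVec_cutVertex_mid, mul_zero]
    linarith [hM.mulVec_cutVertex_neg hij hik hjk hli hlj]
  · rw [cutForm_inr]
    linarith [hM.cutVertex_nonneg hij hik hjk l]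

end IsTripleNegative

theorem exists_ne_ne_ne [Fintype ι] (hι : 3 ≤ Fintype.card ι) (i : ι) :
    ∃ j k, i ≠ j ∧ i ≠ k ∧ j ≠ k := by
  have h : 1 < (Finset.univ.erase i).card := by
    rw [Finset.card_erase_of_mem (Finset.mem_univ i), Finset.card_univ]
    omega
  obtain ⟨j, hj, k, hk, hjk⟩ := Finset.one_lt_card.1 h
  exact ⟨j, k, (Finset.ne_of_mem_erase hj).symm, (Finset.ne_of_mem_erase hk).symm, hjk⟩

namespace IsTripleNegative

theorem exists_cutForm_neg [Fintype ι] (hM : IsTripleNegative M) (hι : 3 ≤ Fintype.card ι) :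
    ∃ y, ∀ q, cutForm M q y < 0 := by
  obtain ⟨y, -, hy⟩ := exists_active_eq (cutForm M) ∅ (fun p _ => by
    rcases p with i | i <;>
      obtain ⟨j, k, hij, hik, hjk⟩ := exists_ne_ne_ne hι i
    · refine ⟨cutVertex M j k i, hM.cutForm_cutVertex_nonpos hjk hij.symm hik.symm, by simp, ?_⟩
      rw [cutForm_inl]
      linarith [hM.mulVec_cutVertex_neg (l := i) hjk hij.symm hik.symm hij hik]
    · refine ⟨cutVertex M i j k, hM.cutForm_cutVertex_nonpos hij hik hjk, by simp, ?_⟩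
      rw [cutForm_inr]
      linarith [hM.cutVertex_left_pos hij hik hjk])
  exact ⟨y, fun q => hy q (notMem_empty q)⟩

theorem exists_pos_mulVec_neg [Fintype ι] (hM : IsTripleNegative M) (hι : 3 ≤ Fintype.card ι) :
    ∃ y : ι → ℝ, (∀ i, 0 < y i) ∧ ∀ i, M.mulVec y i < 0 := by
  obtain ⟨y, hy⟩ := hM.exists_cutForm_neg hι
  refine ⟨y, fun i => ?_, fun i => ?_⟩
  · have := hy (Sum.inr i)
    rw [cutForm_inr] at this
    linarith
  · have := hy (Sum.inl i)
    rw [cutForm_inl] at this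
    linarith

end IsTripleNegative

end Cut

/-! ### Active sets of the cone over a bitruncated simplex -/

/-- The sets `{F'_i | i ∈ T} ∪ {F_i | i ∈ Z}` with `T` and `Z` disjoint and of at most two
elements. -/
def IsBitruncatedActive (J : Set FacetIdx) : Prop :=
  (∀ i, Sum.inl i ∈ J → Sum.inr i ∉ J) ∧
    (∀ i j k, i ≠ j → i ≠ k → j ≠ k → Sum.inl i ∈ J → Sum.inl j ∈ J → Sum.inl k ∉ J) ∧
    ∀ i j k, i ≠ j → i ≠ k → j ≠ k → Sum.inr i ∈ J → Sum.inr j ∈ J → Sum.inr k ∉ J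

theorem Fin.exists_pair_of_triple : ∀ i j k : Fin 5, i ≠ j → i ≠ k → j ≠ k →
    ∃ p q : Fin 5, p ≠ q ∧ ∀ l, l ≠ i → l ≠ j → l ≠ k → l = p ∨ l = q := by
  decide

namespace IsTripleNegative

variable {M : Matrix (Fin 5) (Fin 5) ℝ}

theorem isBitruncatedActive (hM : IsTripleNegative M)
    (hlt : ∀ i j, i ≠ j → M i j * M j i < 4) {y : Fin 5 → ℝ} (hy0 : y ≠ 0)
    (hy : ∀ q, cutForm M q y ≤ 0) : IsBitruncatedActive {q | cutForm M q y = 0} := by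
  have hnn : ∀ i, 0 ≤ y i := fun i => by
    have := hy (Sum.inr i)
    rw [cutForm_inr] at this
    linarith
  have hle : ∀ i, M.mulVec y i ≤ 0 := fun i => by
    have := hy (Sum.inl i)
    rw [cutForm_inl] at this
    linarith
  have hsum : ∀ i, M.mulVec y i = 2 * y i + ∑ j ∈ Finset.univ.erase i, M i j * y j := fun i => by
    rw [Matrix.mulVec, dotProduct, ← Finset.add_sum_erase _ _ (Finset.mem_univ i), hM.diag]
  have hdisj : ∀ i, y i = 0 → M.mulVec y i ≠ 0 := by
    intro i h2 h1
    rw [hsum, h2, mul_zero, zero_add, Finset.sum_eq_zero_iff_of_nonpos fun j hj =>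
      mul_nonpos_of_nonpos_of_nonneg (hM.neg i j (Finset.ne_of_mem_erase hj).symm).le (hnn j)] at h1
    refine hy0 (funext fun j => ?_)
    by_cases hj : j = i
    · rw [hj, h2]; rfl
    · exact (mul_eq_zero.1 (h1 j (Finset.mem_erase.2 ⟨hj, Finset.mem_univ j⟩))).resolve_left
        (hM.neg i j (Ne.symm hj)).ne
  simp only [IsBitruncatedActive, mem_ofPred_eq, cutForm_inl, cutForm_inr, neg_eq_zero,
    mul_eq_zero, one_div, inv_eq_zero, OfNat.ofNat_ne_zero, false_or]
  refine ⟨fun i h1 h2 => hdisj i h2 h1, ?_, ?_⟩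
  · intro i j k hij hik hjk hi hj hk
    have hyi : 0 < y i := (hnn i).lt_of_ne fun h => hdisj i h.symm hi
    have hge : ∀ a b c, a ≠ b → a ≠ c → b ≠ c → M.mulVec y a = 0 →
        0 ≤ 2 * y a + M a b * y b + M a c * y c := by
      intro a b c hab hac hbc ha
      rw [hsum, ← Finset.add_sum_erase _ _ (Finset.mem_erase.2 ⟨hab.symm, Finset.mem_univ b⟩),
        ← Finset.add_sum_erase _ _ (Finset.mem_erase.2 ⟨hbc.symm,
          Finset.mem_erase.2 ⟨hac.symm, Finset.mem_univ c⟩⟩)] at ha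
      have : ∑ x ∈ ((Finset.univ.erase a).erase b).erase c, M a x * y x ≤ 0 := by
        refine Finset.sum_nonpos fun x hx => ?_
        simp only [Finset.mem_erase] at hx
        exact mul_nonpos_of_nonpos_of_nonneg (hM.neg a x hx.2.2.1.symm).le (hnn x)
      linarith
    have h1 := hge i j k hij hik hjk hi
    have h2 := hge j i k hij.symm hjk hik hj
    have h3 := hge k i j hik.symm hjk.symm hij hk
    have c1 : 0 ≤ 4 - M j k * M k j := by linarith [hM.mul_le j k hjk]
    have c2 : 0 ≤ M i k * M k j - 2 * M i j := by
      have := mul_pos_of_neg_of_neg (hM.neg i k hik) (hM.neg k j hjk.symm)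
      linarith [hM.neg i j hij]
    have c3 : 0 ≤ M i j * M j k - 2 * M i k := by
      have := mul_pos_of_neg_of_neg (hM.neg i j hij) (hM.neg j k hjk)
      linarith [hM.neg i k hik]
    have hneg := mul_neg_of_neg_of_pos (hM.minor_neg i j k hij hik hjk) hyi
    linarith [mul_nonneg c1 h1, mul_nonneg c2 h2, mul_nonneg c3 h3]
  · intro i j k hij hik hjk hi hj hk
    obtain ⟨p, q, hpq, hl⟩ := Fin.exists_pair_of_triple i j k hij hik hjk
    have hz : ∀ l, l ≠ p → l ≠ q → y l = 0 := by
      intro l hp hq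
      by_cases h1 : l = i
      · rw [h1, hi]
      by_cases h2 : l = j
      · rw [h2, hj]
      by_cases h3 : l = k
      · rw [h3, hk]
      rcases hl l h1 h2 h3 with h | h
      · exact absurd h hp
      · exact absurd h hq
    have hle2 : ∀ a b, a ≠ b → (∀ l, l ≠ a → l ≠ b → y l = 0) → 2 * y a + M a b * y b ≤ 0 := by
      intro a b hab hz
      have := hle a
      rw [hsum, ← Finset.add_sum_erase _ _ (Finset.mem_erase.2 ⟨hab.symm, Finset.mem_univ b⟩),
        Finset.sum_eq_zero (fun x hx => ?_), add_zero] at this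
      · exact this
      · simp only [Finset.mem_erase] at hx
        rw [hz x hx.2.1 hx.1, mul_zero]
    have h1 := hle2 p q hpq hz
    have h2 := hle2 q p hpq.symm fun l h h' => hz l h' h
    have hq0 : y q = 0 := by
      by_contra hq
      have hq : 0 < y q := (hnn q).lt_of_ne (Ne.symm hq)
      have := mul_le_mul_of_nonpos_left h1 (hM.neg q p hpq.symm).le
      have := mul_pos (sub_pos.2 (hlt p q hpq)) hq
      linarith
    have hp0 : y p = 0 := by
      rw [hq0, mul_zero] at h1
      linarith [hnn p]
    refine hy0 (funext fun l => ?_)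
    by_cases hp : l = p
    · rw [hp, hp0]; rfl
    by_cases hq : l = q
    · rw [hq, hq0]; rfl
    exact hz l hp hq

theorem exists_cutVertex_active (hM : IsTripleNegative M)
    (hlt : ∀ i j, i ≠ j → M i j * M j i < 4) {T Z : Finset (Fin 5)} (hd : Disjoint T Z)
    (hT : T.card = 2) (hZ : Z.card = 2) : ∃ y : Fin 5 → ℝ, (∀ q, cutForm M q y ≤ 0) ∧
      (∀ i, cutForm M (Sum.inl i) y = 0 ↔ i ∈ T) ∧ ∀ i, cutForm M (Sum.inr i) y = 0 ↔ i ∈ Z := by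
  obtain ⟨i, j, hij, rfl⟩ := Finset.card_eq_two.1 hT
  obtain ⟨k, hk⟩ := Finset.card_eq_one.1 (show (({i, j} ∪ Z)ᶜ : Finset (Fin 5)).card = 1 by
    rw [Finset.card_compl, Finset.card_union_of_disjoint hd, hT, hZ]; rfl)
  have hmem : ∀ l, l = k ↔ ¬(l = i ∨ l = j) ∧ l ∉ Z := fun l => by
    rw [← Finset.mem_singleton, ← hk]
    simp [not_or, and_assoc]
  have hkk := (hmem k).1 rfl
  have hik : i ≠ k := fun h => hkk.1 (Or.inl h.symm)
  have hjk : j ≠ k := fun h => hkk.1 (Or.inr h.symm)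
  refine ⟨cutVertex M i j k, hM.cutForm_cutVertex_nonpos hij hik hjk, fun l => ?_, fun l => ?_⟩
  · rw [cutForm_inl, Finset.mem_insert, Finset.mem_singleton]
    constructor
    · intro h
      by_contra hl
      rw [not_or] at hl
      have := hM.mulVec_cutVertex_neg hij hik hjk hl.1 hl.2
      linarith
    · rintro (rfl | rfl)
      · rw [hM.mulVec_cutVertex_left, mul_zero]
      · rw [hM.mulVec_cutVertex_mid, mul_zero]
  · rw [cutForm_inr, neg_eq_zero]
    constructor
    · intro h
      by_contra hl
      by_cases h1 : l = i
      · rw [h1] at h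
        exact (hM.cutVertex_left_pos hij hik hjk).ne' h
      by_cases h2 : l = j
      · rw [h2] at h
        exact (hM.cutVertex_mid_pos hij hik hjk).ne' h
      rw [(hmem l).2 ⟨not_or.2 ⟨h1, h2⟩, hl⟩, cutVertex_right hik hjk] at h
      linarith [hlt i j hij]
    · intro hl
      refine cutVertex_of_ne ?_ ?_ ?_
      · rintro rfl
        exact Finset.disjoint_left.1 hd (by simp) hl
      · rintro rfl
        exact Finset.disjoint_left.1 hd (by simp) hl
      · rintro rfl
        exact hkk.2 hl

theorem exists_active (hM : IsTripleNegative M)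
    (hlt : ∀ i j, i ≠ j → M i j * M j i < 4) {J : Set FacetIdx} (hJ : IsBitruncatedActive J) :
    ∃ y : Fin 5 → ℝ, y ≠ 0 ∧ (∀ q ∈ J, cutForm M q y = 0) ∧ ∀ q ∉ J, cutForm M q y < 0 := by
  classical
  obtain ⟨h1, h2, h3⟩ := hJ
  let T : Finset (Fin 5) := {i | Sum.inl i ∈ J}
  let Z : Finset (Fin 5) := {i | Sum.inr i ∈ J}
  have hT : T.card ≤ 2 := by
    by_contra! h
    obtain ⟨i, hi, j, hj, k, hk, hij, hik, hjk⟩ := Finset.two_lt_card.1 h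
    exact h2 i j k hij hik hjk (by simpa [T] using hi) (by simpa [T] using hj)
      (by simpa [T] using hk)
  have hZ : Z.card ≤ 2 := by
    by_contra! h
    obtain ⟨i, hi, j, hj, k, hk, hij, hik, hjk⟩ := Finset.two_lt_card.1 h
    exact h3 i j k hij hik hjk (by simpa [Z] using hi) (by simpa [Z] using hj)
      (by simpa [Z] using hk)
  have hd : Disjoint T Z := Finset.disjoint_left.2 fun i hi hi' =>
    h1 i (by simpa [T] using hi) (by simpa [Z] using hi')
  have key : ∀ T' Z' : Finset (Fin 5), T ⊆ T' → Z ⊆ Z' → Disjoint T' Z' → T'.card = 2 →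
      Z'.card = 2 → ∃ y : Fin 5 → ℝ, (∀ q, cutForm M q y ≤ 0) ∧ (∀ q ∈ J, cutForm M q y = 0) ∧
        (∀ i, cutForm M (Sum.inl i) y = 0 ↔ i ∈ T') ∧
          ∀ i, cutForm M (Sum.inr i) y = 0 ↔ i ∈ Z' := by
    intro T' Z' hTT hZZ hd' hT' hZ'
    obtain ⟨y, hy, hyT, hyZ⟩ := hM.exists_cutVertex_active hlt hd' hT' hZ'
    refine ⟨y, hy, ?_, hyT, hyZ⟩
    rintro (i | i) hi
    · exact (hyT i).2 (hTT (by simpa [T] using hi))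
    · exact (hyZ i).2 (hZZ (by simpa [Z] using hi))
  have hext : ∀ {A B : Finset (Fin 5)}, Disjoint A B → A.card ≤ 2 → B.card ≤ 2 → ∀ p ∉ A,
      ∃ A' B', A ⊆ A' ∧ B ⊆ B' ∧ Disjoint A' B' ∧ A'.card = 2 ∧ B'.card = 2 ∧ p ∉ A' := by
    intro A B hAB hA hB p hp
    obtain ⟨A', hAA, hA', hcA⟩ := Finset.exists_subsuperset_card_eq (s := A) (t := (Bᶜ).erase p)
      (n := 2) (fun x hx => by
        rw [Finset.mem_erase, Finset.mem_compl]
        exact ⟨fun h => hp (h ▸ hx), Finset.disjoint_left.1 hAB hx⟩) hA (by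
        have h := (Bᶜ).pred_card_le_card_erase (a := p)
        rw [Finset.card_compl, Fintype.card_fin] at h
        omega)
    obtain ⟨B', hBB, hB', hcB⟩ := Finset.exists_subsuperset_card_eq (s := B) (t := A'ᶜ)
      (n := 2) (fun x hx => by
        rw [Finset.mem_compl]
        intro h
        have := Finset.mem_of_mem_erase (hA' h)
        exact Finset.mem_compl.1 this hx) hB (by
        rw [Finset.card_compl, Fintype.card_fin]
        omega)
    refine ⟨A', B', hAA, hBB, Finset.disjoint_left.2 fun x hx hx' =>
      Finset.mem_compl.1 (hB' hx') hx, hcA, hcB, fun h => ?_⟩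
    exact Finset.notMem_erase p _ (hA' h)
  obtain ⟨y, hy1, hy2⟩ := exists_active_eq (cutForm M) J (by
    rintro (p | p) hp
    · obtain ⟨T', Z', a, b, c, d, e, f⟩ := hext hd hT hZ p (by simpa [T] using hp)
      obtain ⟨y, hy, hyJ, hyT, _⟩ := key T' Z' a b c d e
      exact ⟨y, hy, hyJ, (hy _).lt_of_ne fun h => f ((hyT p).1 h)⟩
    · obtain ⟨Z', T', a, b, c, d, e, f⟩ := hext hd.symm hZ hT p (by simpa [Z] using hp)
      obtain ⟨y, hy, hyJ, _, hyZ⟩ := key T' Z' b a c.symm e d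
      exact ⟨y, hy, hyJ, (hy _).lt_of_ne fun h => f ((hyZ p).1 h)⟩)
  refine ⟨y, ?_, hy1, hy2⟩
  rintro rfl
  have hall : ∀ q, q ∈ J := fun q => by
    by_contra h
    simpa using hy2 q h
  exact h1 0 (hall _) (hall _)

/-- The active sets of two such cones are the same. -/
theorem exists_active_congr {M' : Matrix (Fin 5) (Fin 5) ℝ} (hM : IsTripleNegative M)
    (hlt : ∀ i j, i ≠ j → M i j * M j i < 4) (hM' : IsTripleNegative M')
    (hlt' : ∀ i j, i ≠ j → M' i j * M' j i < 4) {y : Fin 5 → ℝ} (hy0 : y ≠ 0)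
    (hy : ∀ q, cutForm M q y ≤ 0) : ∃ y' : Fin 5 → ℝ, y' ≠ 0 ∧ (∀ q, cutForm M' q y' ≤ 0) ∧
      ∀ q, cutForm M' q y' = 0 ↔ cutForm M q y = 0 := by
  obtain ⟨y', h0, h1, h2⟩ := hM'.exists_active hlt' (hM.isBitruncatedActive hlt hy0 hy)
  refine ⟨y', h0, fun q => ?_, fun q => ⟨fun h => ?_, fun h => h1 q h⟩⟩
  · by_cases hq : cutForm M q y = 0
    · exact (h1 q hq).le
    · exact (h2 q hq).le
  · by_contra hq
    exact (h2 q hq).ne h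

end IsTripleNegative

/-! ### Exposed faces of polyhedra -/

theorem isExposed_iff_isActiveFace {E κ : Type*} [Finite κ] [NormedAddCommGroup E]
    [NormedSpace ℝ E] (ℓ : κ → StrongDual ℝ E) (c : κ → ℝ) (B : Set E) :
    IsExposed ℝ {x | ∀ k, ℓ k x ≤ c k} B ↔
      IsActiveFace {x | ∀ k, ℓ k x ≤ c k} (fun x => {k | ℓ k x = c k}) B := by
  classical
  have := Fintype.ofFinite κ
  rcases B.eq_empty_or_nonempty with rfl | hB
  · exact ⟨fun _ => Or.inl rfl, fun _ => isExposed_empty⟩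
  constructor
  · intro hexp
    obtain ⟨l, hl⟩ := hexp hB
    right
    obtain ⟨x₀, hx₀, hmin⟩ := exists_forall_act_subset (fun x => {k | ℓ k x = c k}) hB (by
      intro x hx y hy
      rw [hl] at hx hy
      have hlxy : l x = l y := le_antisymm (hy.2 x hx.1) (hx.2 y hy.1)
      refine ⟨(1 / 2 : ℝ) • x + (1 / 2 : ℝ) • y, ?_, ?_⟩
      · rw [hl]
        refine ⟨fun k => ?_, fun z hz => ?_⟩
        · have h1 := hx.1 k
          have h2 := hy.1 k
          simp only [map_add, map_smul, smul_eq_mul]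
          linarith
        · have h1 := hx.2 z hz
          simp only [map_add, map_smul, smul_eq_mul]
          linarith
      · intro k hk
        have h1 := hx.1 k
        have h2 := hy.1 k
        simp only [mem_ofPred_eq, map_add, map_smul, smul_eq_mul] at hk
        exact ⟨show ℓ k x = c k by linarith, show ℓ k y = c k by linarith⟩)
    have hx₀' := hl ▸ hx₀
    refine ⟨x₀, hx₀'.1, Subset.antisymm (fun x hx => ⟨(hl ▸ hx).1, hmin x hx⟩) ?_⟩
    rintro x ⟨hx, hsub⟩
    obtain ⟨ε, hε, hle⟩ := exists_pos_forall_add_mul_nonpos (fun k => ℓ k x₀ - c k)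
      (fun k => ℓ k x₀ - ℓ k x) (fun k => sub_nonpos.2 (hx₀'.1 k)) (fun k hk => by
        have h1 : ℓ k x₀ = c k := sub_eq_zero.1 hk
        have h2 : ℓ k x = c k := hsub h1
        rw [h1, h2, sub_self])
    have h1 := hx₀'.2 (x₀ + ε • (x₀ - x)) (fun k => by
      have := hle k
      simp only [map_add, map_smul, map_sub, smul_eq_mul]
      linarith)
    simp only [map_add, map_smul, map_sub, smul_eq_mul] at h1
    have h2 : l x₀ ≤ l x := by
      by_contra! h
      nlinarith [mul_pos hε (sub_pos.2 h)]
    rw [hl]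
    exact ⟨hx, fun z hz => (hx₀'.2 z hz).trans h2⟩
  · rintro (rfl | ⟨x₀, hx₀, rfl⟩)
    · exact isExposed_empty
    intro _
    refine ⟨∑ k with ℓ k x₀ = c k, ℓ k, ?_⟩
    have hsum : ∀ z, (∑ k with ℓ k x₀ = c k, ℓ k) z = ∑ k with ℓ k x₀ = c k, ℓ k z := fun z => by
      simp
    ext x
    refine and_congr_right fun hx => ?_
    simp only [hsum]
    constructor
    · intro hsub z hz
      refine Finset.sum_le_sum fun k hk => ?_
      have h1 : ℓ k x = c k := hsub (Finset.mem_filter.1 hk).2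
      rw [h1]
      exact hz k
    · intro hmax k hk
      by_contra hne
      have hlt : ℓ k x < c k := (hx k).lt_of_ne hne
      refine absurd (hmax x₀ hx₀) (not_le.2 (Finset.sum_lt_sum (fun j hj => ?_)
        ⟨k, Finset.mem_filter.2 ⟨Finset.mem_univ k, hk⟩, ?_⟩))
      · rw [(Finset.mem_filter.1 hj).2]
        exact hx j
      · rw [show ℓ k x₀ = c k from hk]
        exact hlt

/-! ### Barycentric coordinates of a regular simplex -/

namespace IsRegularSimplex

variable {v : Fin 5 → E4}

theorem exists_inner_eq (hv : IsRegularSimplex v) : ∃ c : ℝ, 0 < c ∧ (∀ i, ‖v i‖ = c) ∧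
    ∀ i j, inner ℝ (v i) (v j) = if i = j then c ^ 2 else -(c ^ 2 / 4) := by
  obtain ⟨hsum, l, hl, hd⟩ := hv
  have hdist : ∀ i j, i ≠ j → ‖v i‖ ^ 2 - 2 * inner ℝ (v i) (v j) + ‖v j‖ ^ 2 = l ^ 2 := by
    intro i j hij
    rw [← norm_sub_sq_real, ← dist_eq_norm, hd i j hij]
  have hin : ∀ i, ∑ j, inner ℝ (v i) (v j) = 0 := fun i => by
    rw [← inner_sum, hsum, inner_zero_right]
  have hN : ∀ i, 5 * ‖v i‖ ^ 2 + ∑ j, ‖v j‖ ^ 2 = 4 * l ^ 2 := by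
    intro i
    have h1 : ∑ j, (‖v i‖ ^ 2 - 2 * inner ℝ (v i) (v j) + ‖v j‖ ^ 2) =
        ∑ j, if i = j then 0 else l ^ 2 := by
      refine Finset.sum_congr rfl fun j _ => ?_
      split_ifs with h
      · rw [← h, real_inner_self_eq_norm_sq]; ring
      · exact hdist i j h
    rw [Finset.sum_add_distrib, Finset.sum_sub_distrib, ← Finset.mul_sum, hin] at h1
    have h2 : (∑ j, if i = j then 0 else l ^ 2) = 4 * l ^ 2 := by
      have : ∀ j, (if i = j then 0 else l ^ 2) = l ^ 2 - if i = j then l ^ 2 else 0 := fun j => by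
        split_ifs <;> ring
      simp_rw [this]
      rw [Finset.sum_sub_distrib, Finset.sum_ite_eq]
      simp
      ring
    rw [h2] at h1
    simpa using h1
  have hsame : ∀ i, ‖v i‖ = ‖v 0‖ := fun i => by
    have := hN i
    have := hN 0
    exact (pow_left_inj₀ (norm_nonneg _) (norm_nonneg _) two_ne_zero).1 (by linarith)
  have hl2 : 5 * ‖v 0‖ ^ 2 = 2 * l ^ 2 := by
    have := hN 0
    simp only [hsame, Finset.sum_const, Finset.card_univ, Fintype.card_fin, nsmul_eq_mul] at this
    push_cast at this
    linarith
  refine ⟨‖v 0‖, (norm_nonneg _).lt_of_ne fun h => ?_, hsame, fun i j => ?_⟩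
  · rw [← h] at hl2
    nlinarith [pow_pos hl 2]
  · split_ifs with h
    · rw [h, real_inner_self_eq_norm_sq, hsame]
    · have := hdist i j h
      rw [hsame i, hsame j] at this
      linarith

theorem inner_sum_smul (hv : IsRegularSimplex v) (i : Fin 5) (w : Fin 5 → ℝ) :
    inner ℝ (v i) (∑ j, w j • v j) = ‖v i‖ ^ 2 * (5 / 4 * w i - (∑ j, w j) / 4) := by
  obtain ⟨c, -, hc, hin⟩ := hv.exists_inner_eq
  rw [inner_sum, hc]
  simp only [inner_smul_right, hin]
  have : ∀ j, (w j * if i = j then c ^ 2 else -(c ^ 2 / 4)) =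
      (if i = j then 5 / 4 * (w j * c ^ 2) else 0) - c ^ 2 / 4 * w j := fun j => by
    split_ifs <;> ring
  simp_rw [this]
  rw [Finset.sum_sub_distrib, Finset.sum_ite_eq, ← Finset.mul_sum]
  simp
  ring

theorem norm_pos (hv : IsRegularSimplex v) (i : Fin 5) : 0 < ‖v i‖ := by
  obtain ⟨c, h, hc, -⟩ := hv.exists_inner_eq
  rwa [hc]

theorem norm_eq (hv : IsRegularSimplex v) (i j : Fin 5) : ‖v i‖ = ‖v j‖ := by
  obtain ⟨c, h, hc, -⟩ := hv.exists_inner_eq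
  rw [hc, hc]

/-- Homogeneous barycentric coordinates. -/
def coordEquiv (hv : IsRegularSimplex v) : Vec 4 ≃ₗ[ℝ] E4 × ℝ :=
  LinearMap.linearEquivOfInjective
    ((Fintype.linearCombination ℝ v).prod (Fintype.linearCombination ℝ fun _ => (1 : ℝ)))
    (by
      rw [← LinearMap.ker_eq_bot, LinearMap.ker_eq_bot']
      intro w hw
      have h1 : ∑ j, w j • v j = 0 := congrArg Prod.fst hw
      have h2 : ∑ j, w j = 0 := by
        have := congrArg Prod.snd hw
        simpa [Fintype.linearCombination_apply] using this
      ext i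
      have h3 := hv.inner_sum_smul i w
      have h4 := hv.norm_pos i
      rw [h1, h2, inner_zero_right] at h3
      have : ‖v i‖ ^ 2 * (5 / 4 * w i) = 0 := by linarith
      simpa [h4.ne'] using this)
    (by simp)

theorem coordEquiv_apply (hv : IsRegularSimplex v) (w : Vec 4) :
    hv.coordEquiv w = (∑ j, w j • v j, ∑ j, w j) := by
  change ((Fintype.linearCombination ℝ v).prod
    (Fintype.linearCombination ℝ fun _ => (1 : ℝ))) w = _
  refine Prod.ext ?_ ?_
  · exact Fintype.linearCombination_apply ℝ v w
  · refine (Fintype.linearCombination_apply ℝ (fun _ => (1 : ℝ)) w).trans ?_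
    simp

end IsRegularSimplex

/-- The matrix with diagonal entries `2` and off-diagonal entries `-m`. -/
def simplexMatrix (m : ℝ) : Matrix (Fin 5) (Fin 5) ℝ :=
  Matrix.of fun i j => if i = j then 2 else -m

theorem simplexMatrix_mulVec (m : ℝ) (w : Fin 5 → ℝ) (i : Fin 5) :
    (simplexMatrix m).mulVec w i = (2 + m) * w i - m * ∑ j, w j := by
  simp only [Matrix.mulVec, dotProduct, simplexMatrix, Matrix.of_apply]
  have : ∀ j, (if i = j then 2 else -m) * w j =
      (if i = j then (2 + m) * w j else 0) - m * w j := fun j => by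
    split_ifs <;> ring
  simp_rw [this]
  rw [Finset.sum_sub_distrib, Finset.sum_ite_eq, ← Finset.mul_sum]
  simp

theorem simplexMatrix_of_ne (m : ℝ) {i j : Fin 5} (h : i ≠ j) : simplexMatrix m i j = -m := by
  simp [simplexMatrix, h]

theorem isTripleNegative_simplexMatrix {m : ℝ} (h1 : 1 < m) (h2 : m ≤ 2) :
    IsTripleNegative (simplexMatrix m) where
  diag i := by simp [simplexMatrix]
  neg i j h := by rw [simplexMatrix_of_ne m h]; linarith
  mul_le i j h := by rw [simplexMatrix_of_ne m h, simplexMatrix_of_ne m h.symm]; nlinarith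
  minor_neg i j k hij hik hjk := by
    simp only [simplexMatrix_of_ne m hij, simplexMatrix_of_ne m hik, simplexMatrix_of_ne m hjk,
      simplexMatrix_of_ne m hij.symm, simplexMatrix_of_ne m hik.symm,
      simplexMatrix_of_ne m hjk.symm]
    have h3 : 1 < m ^ 2 := by nlinarith
    have h4 : 1 < m ^ 3 := by nlinarith
    nlinarith

namespace IsRegularSimplex

variable {v : Fin 5 → E4} {s m : ℝ} {w : Vec 4} {x : E4}

theorem inner_of_coordEquiv (hv : IsRegularSimplex v) (hw : hv.coordEquiv w = (x, 1))
    (i : Fin 5) : inner ℝ (v i) x = ‖v i‖ ^ 2 * (5 / 4 * w i - 1 / 4) := by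
  rw [hv.coordEquiv_apply, Prod.mk.injEq] at hw
  rw [← hw.1, hv.inner_sum_smul, hw.2]

/-- The defining functional of the `k`-th facet is a positive multiple of the `k`-th form. -/
theorem exists_pos_smul_cutForm (hv : IsRegularSimplex v) (hm : 0 < m)
    (hs : 2 * s * (2 + m) = ‖v 0‖ * (2 * m - 1)) (k : FacetIdx) :
    ∃ K : ℝ, 0 < K ∧ ∀ w x, hv.coordEquiv w = (x, 1) →
      (x ∈ cutHalfSpace v s k ↔ K * cutForm (simplexMatrix m) k w ≤ 0) ∧
      (x ∈ cutHyperplane v s k ↔ K * cutForm (simplexMatrix m) k w = 0) := by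
  have hc := hv.norm_pos 0
  rcases k with i | i
  · refine ⟨5 * ‖v 0‖ ^ 2 / (2 * (2 + m)) * 2, by positivity, fun w x hw => ?_⟩
    have h1 := hv.inner_of_coordEquiv hw i
    have h2 : ∑ j, w j = 1 := by
      rw [hv.coordEquiv_apply, Prod.mk.injEq] at hw; exact hw.2
    have h3 : 5 * ‖v 0‖ ^ 2 / (2 * (2 + m)) * 2 * cutForm (simplexMatrix m) (Sum.inl i) w =
        2 * (inner ℝ (v i) x - ‖v i‖ * s) := by
      have hs' : s = ‖v 0‖ * (2 * m - 1) / (2 * (2 + m)) := by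
        field_simp
        linarith
      rw [cutForm_inl, simplexMatrix_mulVec, h2, h1, hv.norm_eq i 0, hs']
      field_simp
      ring
    rw [h3]
    change (inner ℝ (v i) x ≤ ‖v i‖ * s ↔ _) ∧ (inner ℝ (v i) x = ‖v i‖ * s ↔ _)
    exact ⟨⟨fun h => by linarith, fun h => by linarith⟩,
      ⟨fun h => by linarith, fun h => by linarith⟩⟩
  · refine ⟨5 / 4 * ‖v i‖ ^ 2, by have := hv.norm_pos i; positivity, fun w x hw => ?_⟩
    have h1 := hv.inner_of_coordEquiv hw i
    rw [cutForm_inr]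
    change (-(‖v i‖ ^ 2 / 4) ≤ inner ℝ (v i) x ↔ _) ∧
      (inner ℝ (v i) x = -(‖v i‖ ^ 2 / 4) ↔ _)
    rw [h1]
    exact ⟨⟨fun h => by linarith, fun h => by linarith⟩,
      ⟨fun h => by linarith, fun h => by linarith⟩⟩

theorem mem_cutHalfSpace_iff (hv : IsRegularSimplex v) (hm : 0 < m)
    (hs : 2 * s * (2 + m) = ‖v 0‖ * (2 * m - 1)) (hw : hv.coordEquiv w = (x, 1)) (k : FacetIdx) :
    x ∈ cutHalfSpace v s k ↔ cutForm (simplexMatrix m) k w ≤ 0 := by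
  obtain ⟨K, hK, h⟩ := hv.exists_pos_smul_cutForm hm hs k
  rw [(h w x hw).1, mul_nonpos_iff_pos_imp_nonpos]
  exact ⟨fun h => h.1 hK, fun h => ⟨fun _ => h, fun _ => hK.le⟩⟩

theorem mem_cutHyperplane_iff (hv : IsRegularSimplex v) (hm : 0 < m)
    (hs : 2 * s * (2 + m) = ‖v 0‖ * (2 * m - 1)) (hw : hv.coordEquiv w = (x, 1)) (k : FacetIdx) :
    x ∈ cutHyperplane v s k ↔ cutForm (simplexMatrix m) k w = 0 := by
  obtain ⟨K, hK, h⟩ := hv.exists_pos_smul_cutForm hm hs k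
  rw [(h w x hw).2, mul_eq_zero, or_iff_right hK.ne']

theorem mem_cutSimplex_iff (hv : IsRegularSimplex v) (hm : 0 < m)
    (hs : 2 * s * (2 + m) = ‖v 0‖ * (2 * m - 1)) (hw : hv.coordEquiv w = (x, 1)) :
    x ∈ cutSimplex v s ↔ ∀ k, cutForm (simplexMatrix m) k w ≤ 0 := by
  simp only [cutSimplex, mem_iInter, hv.mem_cutHalfSpace_iff hm hs hw]

end IsRegularSimplex

theorem sum_pos_of_cutForm_nonpos {M : Matrix (Fin 5) (Fin 5) ℝ} {y : Vec 4} (hy0 : y ≠ 0)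
    (hy : ∀ q, cutForm M q y ≤ 0) : 0 < ∑ i, y i := by
  have hnn : ∀ i, 0 ≤ y i := fun i => by
    have := hy (Sum.inr i)
    rw [cutForm_inr] at this
    linarith
  refine (Finset.sum_nonneg fun i _ => hnn i).lt_of_ne fun h => hy0 (funext fun i => ?_)
  exact (Finset.sum_eq_zero_iff_of_nonneg fun i _ => hnn i).1 h.symm i (Finset.mem_univ i)

/-! ### Combinatorial equivalence with the bitruncated simplex -/

/-- The boundary hyperplanes through a given point. -/
def cutAct (v : Fin 5 → E4) (s : ℝ) (x : E4) : Set FacetIdx := {k | x ∈ cutHyperplane v s k}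

theorem isExposed_cutSimplex_iff (v : Fin 5 → E4) (s : ℝ) (B : Set E4) :
    IsExposed ℝ (cutSimplex v s) B ↔ IsActiveFace (cutSimplex v s) (cutAct v s) B := by
  let ℓ : FacetIdx → StrongDual ℝ E4 :=
    Sum.elim (fun i => innerSL ℝ (v i)) (fun i => -innerSL ℝ (v i))
  let c : FacetIdx → ℝ := Sum.elim (fun i => ‖v i‖ * s) (fun i => ‖v i‖ ^ 2 / 4)
  have h1 : cutSimplex v s = {x | ∀ k, ℓ k x ≤ c k} := by
    ext x
    simp only [cutSimplex, mem_iInter, mem_ofPred_eq]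
    refine forall_congr' fun k => ?_
    rcases k with i | i
    · rfl
    · change -(‖v i‖ ^ 2 / 4) ≤ inner ℝ (v i) x ↔ -inner ℝ (v i) x ≤ ‖v i‖ ^ 2 / 4
      exact neg_le
  have h2 : cutAct v s = fun x => {k | ℓ k x = c k} := by
    funext x
    ext k
    rcases k with i | i
    · rfl
    · change inner ℝ (v i) x = -(‖v i‖ ^ 2 / 4) ↔ -inner ℝ (v i) x = ‖v i‖ ^ 2 / 4
      exact neg_eq_iff_eq_neg.symm
  rw [h1, h2]
  exact isExposed_iff_isActiveFace ℓ c B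

theorem isCombBitruncatedSimplex_of_form_eq (P : MirrorPolytope 4 FacetIdx)
    {M : Matrix (Fin 5) (Fin 5) ℝ} (hP : P.form = cutForm M) (hM : IsTripleNegative M)
    (hlt : ∀ i j, i ≠ j → M i j * M j i < 4) : IsCombBitruncatedSimplex P := by
  intro v hv s hs1 hs2
  have hc := hv.norm_pos 0
  obtain ⟨m, hm1, hm2, hs⟩ : ∃ m : ℝ, 1 < m ∧ m < 2 ∧
      2 * s * (2 + m) = ‖v 0‖ * (2 * m - 1) := by
    have hd : 0 < 2 * (‖v 0‖ - s) := by linarith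
    refine ⟨(4 * s + ‖v 0‖) / (2 * (‖v 0‖ - s)), ?_, ?_, ?_⟩
    · rw [lt_div_iff₀ hd]; linarith
    · rw [div_lt_iff₀ hd]; linarith
    · have : ‖v 0‖ - s ≠ 0 := by linarith
      field_simp
      ring
  have hN := isTripleNegative_simplexMatrix hm1 hm2.le
  have hNlt : ∀ i j, i ≠ j → simplexMatrix m i j * simplexMatrix m j i < 4 := by
    intro i j h
    rw [simplexMatrix_of_ne m h, simplexMatrix_of_ne m h.symm]
    nlinarith
  have hm : 0 < m := by linarith
  have hact : P.act '' P.carrier = cutAct v s '' cutSimplex v s := by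
    ext J
    constructor
    · rintro ⟨x, hx, rfl⟩
      obtain ⟨y, rfl⟩ := toSphere_surjective x
      rw [P.mem_carrier, hP] at hx
      obtain ⟨z, hz0, hz, hzy⟩ := hM.exists_active_congr hlt hN hNlt y.2 hx
      have hpos := sum_pos_of_cutForm_nonpos hz0 hz
      have hw : hv.coordEquiv ((∑ i, z i)⁻¹ • z) =
          ((hv.coordEquiv ((∑ i, z i)⁻¹ • z)).1, 1) := by
        refine Prod.ext rfl ?_
        rw [hv.coordEquiv_apply]
        simp only [Pi.smul_apply, smul_eq_mul, ← Finset.mul_sum]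
        exact inv_mul_cancel₀ hpos.ne'
      refine ⟨_, (hv.mem_cutSimplex_iff hm hs hw).2 fun k => ?_, ?_⟩
      · rw [map_smul, smul_eq_mul]
        exact mul_nonpos_of_nonneg_of_nonpos (inv_pos.2 hpos).le (hz k)
      · ext k
        rw [P.mem_act, hP, ← hzy]
        change _ ∈ cutHyperplane v s k ↔ _
        rw [hv.mem_cutHyperplane_iff hm hs hw, map_smul, smul_eq_mul, mul_eq_zero,
          or_iff_right (inv_pos.2 hpos).ne']
    · rintro ⟨x, hx, rfl⟩
      have hw : hv.coordEquiv (hv.coordEquiv.symm (x, 1)) = (x, 1) :=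
        LinearEquiv.apply_symm_apply _ _
      rw [hv.mem_cutSimplex_iff hm hs hw] at hx
      have hw0 : hv.coordEquiv.symm (x, 1) ≠ 0 := fun h => by
        rw [h, map_zero] at hw
        exact zero_ne_one (congrArg Prod.snd hw)
      obtain ⟨z, hz0, hz, hzy⟩ := hN.exists_active_congr hNlt hM hlt hw0 hx
      refine ⟨toSphere ⟨z, hz0⟩, P.mem_carrier.2 (by rw [hP]; exact hz), ?_⟩
      ext k
      rw [P.mem_act, hP, hzy]
      exact (hv.mem_cutHyperplane_iff hm hs hw k).symm
  refine ⟨activeFaceOrderIso hact P.isFace_iff (isExposed_cutSimplex_iff v s), fun k => ?_⟩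
  exact transferFace_setOf hact (fun J => k ∈ J)

/-! ### The ideal rectified simplex -/

theorem half_of_mem_extremePoints {v : Fin 5 → E4} (hv : IsRegularSimplex v) {x : E4}
    (hx : x ∈ (cutSimplex v (3 * ‖v 0‖ / 8)).extremePoints ℝ) {w : Vec 4}
    (hw : hv.coordEquiv w = (x, 1)) (i : Fin 5) : w i = 0 ∨ w i = 1 / 2 := by
  have hs : 2 * (3 * ‖v 0‖ / 8) * (2 + 2) = ‖v 0‖ * (2 * 2 - 1) := by ring
  have hmem : ∀ {z u}, hv.coordEquiv z = (u, 1) →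
      (u ∈ cutSimplex v (3 * ‖v 0‖ / 8) ↔ ∀ i, 0 ≤ z i ∧ z i ≤ 1 / 2) := by
    intro z u hz
    have hsum : ∑ j, z j = 1 := by
      rw [hv.coordEquiv_apply, Prod.mk.injEq] at hz; exact hz.2
    rw [hv.mem_cutSimplex_iff two_pos hs hz, Sum.forall]
    simp only [cutForm_inl, cutForm_inr, simplexMatrix_mulVec, hsum]
    rw [← forall_and]
    exact forall_congr' fun i => ⟨fun h => ⟨by linarith, by linarith⟩,
      fun h => ⟨by linarith, by linarith⟩⟩
  rw [mem_extremePoints_iff_left] at hx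
  obtain ⟨hxA, hxe⟩ := hx
  have hwb := (hmem hw).1 hxA
  by_contra hi
  rw [not_or] at hi
  have hi0 : 0 < w i := (hwb i).1.lt_of_ne (Ne.symm hi.1)
  have hi1 : w i < 1 / 2 := (hwb i).2.lt_of_ne hi.2
  have hsum : ∑ j, w j = 1 := by
    rw [hv.coordEquiv_apply, Prod.mk.injEq] at hw; exact hw.2
  obtain ⟨j, hji, hj0, hj1⟩ : ∃ j, j ≠ i ∧ w j ≠ 0 ∧ w j ≠ 1 / 2 := by
    by_contra! hcon
    have hnat : ∀ j, ∃ n : ℕ, j ≠ i → w j = n / 2 := fun j => by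
      by_cases h0 : w j = 0
      · exact ⟨0, fun _ => by simp [h0]⟩
      · exact ⟨1, fun h => by simpa using hcon j h h0⟩
    choose n hn using hnat
    rw [← Finset.add_sum_erase _ _ (Finset.mem_univ i),
      Finset.sum_congr rfl fun j hj => hn j (Finset.ne_of_mem_erase hj), ← Finset.sum_div,
      ← Nat.cast_sum] at hsum
    have h1 : (1 : ℝ) < (∑ j ∈ Finset.univ.erase i, n j : ℕ) := by linarith
    have h2 : ((∑ j ∈ Finset.univ.erase i, n j : ℕ) : ℝ) < 2 := by linarith
    have h1' : 1 < ∑ j ∈ Finset.univ.erase i, n j := by exact_mod_cast h1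
    have h2' : ∑ j ∈ Finset.univ.erase i, n j < 2 := by exact_mod_cast h2
    omega
  have hj0 : 0 < w j := (hwb j).1.lt_of_ne (Ne.symm hj0)
  have hj1 : w j < 1 / 2 := (hwb j).2.lt_of_ne hj1
  obtain ⟨δ, hδ, hδ1, hδ2, hδ3, hδ4⟩ : ∃ δ : ℝ, 0 < δ ∧ δ ≤ w i ∧ δ ≤ 1 / 2 - w i ∧ δ ≤ w j ∧
      δ ≤ 1 / 2 - w j :=
    ⟨min (min (w i) (1 / 2 - w i)) (min (w j) (1 / 2 - w j)), by
      simp only [lt_min_iff]; exact ⟨⟨hi0, by linarith⟩, hj0, by linarith⟩,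
      (min_le_left _ _).trans (min_le_left _ _), (min_le_left _ _).trans (min_le_right _ _),
      (min_le_right _ _).trans (min_le_left _ _), (min_le_right _ _).trans (min_le_right _ _)⟩
  let d : Vec 4 := Pi.single i 1 - Pi.single j 1
  have hdi : d i = 1 := by simp [d, hji.symm]
  have hdj : d j = -1 := by simp [d, hji]
  have hdk : ∀ k, k ≠ i → k ≠ j → d k = 0 := fun k h h' => by simp [d, h, h']
  have hd : hv.coordEquiv d = ((hv.coordEquiv d).1, 0) := by
    refine Prod.ext rfl ?_
    rw [hv.coordEquiv_apply]
    simp [d]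
  have hmv : ∀ ε : ℝ, |ε| ≤ δ → x + ε • (hv.coordEquiv d).1 ∈ cutSimplex v (3 * ‖v 0‖ / 8) := by
    intro ε hε
    obtain ⟨hε1, hε2⟩ := abs_le.1 hε
    refine (hmem (z := w + ε • d) ?_).2 fun k => ?_
    · rw [map_add, map_smul, hw, hd]
      simp
    · simp only [Pi.add_apply, Pi.smul_apply, smul_eq_mul]
      by_cases hki : k = i
      · rw [hki, hdi]; exact ⟨by linarith, by linarith⟩
      by_cases hkj : k = j
      · rw [hkj, hdj]; exact ⟨by linarith, by linarith⟩
      rw [hdk k hki hkj, mul_zero, add_zero]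
      exact hwb k
  have heq := hxe _ (hmv δ (abs_of_pos hδ).le) _ (hmv (-δ) (by rw [abs_neg, abs_of_pos hδ]))
    ⟨1 / 2, 1 / 2, by norm_num, by norm_num, by norm_num, by module⟩
  have h0 : (hv.coordEquiv d).1 = 0 := by simpa [hδ.ne'] using heq
  rw [h0] at hd
  have : d = 0 := hv.coordEquiv.map_eq_zero_iff.1 hd
  rw [this] at hdi
  simp at hdi

theorem extremePoints_subset_sphere {v : Fin 5 → E4} (hv : IsRegularSimplex v) {r : ℝ}
    (hr0 : 0 ≤ r) (hr : r ^ 2 = 3 * ‖v 0‖ ^ 2 / 8) :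
    (cutSimplex v (3 * ‖v 0‖ / 8)).extremePoints ℝ ⊆ Metric.sphere 0 r := by
  intro x hx
  have hw : hv.coordEquiv (hv.coordEquiv.symm (x, 1)) = (x, 1) :=
    LinearEquiv.apply_symm_apply _ _
  set w := hv.coordEquiv.symm (x, 1)
  have hh := half_of_mem_extremePoints hv hx hw
  have hin := hv.inner_of_coordEquiv hw
  rw [hv.coordEquiv_apply, Prod.mk.injEq] at hw
  have h1 : inner ℝ x x = ∑ j, w j * inner ℝ (v j) x := by
    conv_lhs => rw [← hw.1]
    rw [sum_inner, hw.1]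
    simp [inner_smul_left]
  have h2 : ∀ j, w j * inner ℝ (v j) x = 3 / 8 * ‖v 0‖ ^ 2 * w j := by
    intro j
    rw [hin, hv.norm_eq j 0]
    rcases hh j with h | h <;> rw [h] <;> ring
  rw [Finset.sum_congr rfl fun j _ => h2 j, ← Finset.mul_sum, hw.2,
    real_inner_self_eq_norm_sq] at h1
  rw [mem_sphere_zero_iff_norm]
  exact (pow_left_inj₀ (norm_nonneg _) hr0 two_ne_zero).1 (by linarith)

theorem lorentz_coordEquiv {v : Fin 5 → E4} (hv : IsRegularSimplex v) {r : ℝ}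
    (hr : r ^ 2 = 3 * ‖v 0‖ ^ 2 / 8) (w w' : Vec 4) :
    lorentz r (hv.coordEquiv w) (hv.coordEquiv w') =
      5 / 4 * ‖v 0‖ ^ 2 * (∑ i, w i * w' i - (∑ i, w i) * (∑ i, w' i) / 2) := by
  rw [hv.coordEquiv_apply, hv.coordEquiv_apply, lorentz, hr]
  simp only [sum_inner, inner_smul_left, hv.inner_sum_smul, hv.norm_eq _ 0, conj_trivial]
  have h : ∀ j, w j * (‖v 0‖ ^ 2 * (5 / 4 * w' j - (∑ i, w' i) / 4)) =
      5 / 4 * ‖v 0‖ ^ 2 * (w j * w' j) - ‖v 0‖ ^ 2 * (∑ i, w' i) / 4 * w j := fun j => by ring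
  simp_rw [h, Finset.sum_sub_distrib, ← Finset.mul_sum]
  ring

theorem isIdealHyperbolicRectifiedSimplex_of_form_eq (P : MirrorPolytope 4 FacetIdx)
    (hP : P.form = cutForm (simplexMatrix 2))
    (hinl : ∀ j, P.vec (Sum.inl j) = Pi.single j 2)
    (hinr : ∀ j, P.vec (Sum.inr j) = fun i => if i = j then -2 else 1) :
    IsIdealHyperbolicRectifiedSimplex P := by
  intro v hv
  have hc := hv.norm_pos 0
  have hr : √(3 * ‖v 0‖ ^ 2 / 8) ^ 2 = 3 * ‖v 0‖ ^ 2 / 8 := Real.sq_sqrt (by positivity)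
  have hs : 2 * (3 * ‖v 0‖ / 8) * (2 + 2) = ‖v 0‖ * (2 * 2 - 1) := by ring
  refine ⟨√(3 * ‖v 0‖ ^ 2 / 8), by positivity,
    extremePoints_subset_sphere hv (Real.sqrt_nonneg _) hr, hv.coordEquiv, ?_⟩
  have key : ∀ p : (FacetIdx → ℝ) → Prop, (∀ c : ℝ, 0 < c → ∀ a, p (c • a) ↔ p a) →
      {x | ∃ y : {y : Vec 4 // y ≠ 0}, x = toSphere y ∧
        (∀ k, cutForm (simplexMatrix 2) k y.1 ≤ 0) ∧
          p (fun k => cutForm (simplexMatrix 2) k y.1)} =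
      sphereImage {w | ∃ x, (x ∈ cutSimplex v (3 * ‖v 0‖ / 8) ∧
        p (fun k => cutForm (simplexMatrix 2) k w)) ∧ hv.coordEquiv w = (x, 1)} := by
    intro p hp
    ext x
    constructor
    · rintro ⟨y, rfl, hy, hpy⟩
      have hpos := inv_pos.2 (sum_pos_of_cutForm_nonpos y.2 hy)
      have hw : hv.coordEquiv ((∑ i, y.1 i)⁻¹ • y.1) =
          ((hv.coordEquiv ((∑ i, y.1 i)⁻¹ • y.1)).1, 1) := by
        refine Prod.ext rfl ?_
        rw [hv.coordEquiv_apply]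
        simp only [Pi.smul_apply, smul_eq_mul, ← Finset.mul_sum]
        exact inv_mul_cancel₀ (inv_pos.1 hpos).ne'
      refine ⟨⟨_, smul_ne_zero hpos.ne' y.2⟩, ⟨_, ⟨(hv.mem_cutSimplex_iff two_pos hs hw).2
        fun k => ?_, ?_⟩, hw⟩, ?_⟩
      · rw [map_smul, smul_eq_mul]
        exact mul_nonpos_of_nonneg_of_nonpos hpos.le (hy k)
      · have := (hp _ hpos _).2 hpy
        simp only [map_smul]
        exact this
      · exact ray_pos_smul y.2 hpos _
    · rintro ⟨w, ⟨x, ⟨hx, hpw⟩, hw⟩, rfl⟩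
      exact ⟨w, rfl, (hv.mem_cutSimplex_iff two_pos hs hw).1 hx, hpw⟩
  refine ⟨?_, fun k => ?_, fun k w w' => ?_⟩
  · have := key (fun _ => True) (by simp)
    simp only [and_true] at this
    refine Eq.trans ?_ this
    ext x
    obtain ⟨y, rfl⟩ := toSphere_surjective x
    rw [P.mem_carrier, hP]
    constructor
    · exact fun h => ⟨y, rfl, h⟩
    · rintro ⟨y', h1, h2⟩
      rw [← hP] at h2 ⊢
      rw [← P.mem_carrier] at h2 ⊢
      rwa [h1]
  · refine (Eq.trans ?_ (key (fun a => a k = 0) (fun c hc a => by simp [hc.ne']))).trans ?_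
    · rw [P.facet_eq]
      ext x
      obtain ⟨y, rfl⟩ := toSphere_surjective x
      change toSphere y ∈ P.carrier ∧ k ∈ P.act (toSphere y) ↔ _
      constructor
      · rintro ⟨h1, h2⟩
        rw [P.mem_carrier, hP] at h1
        rw [P.mem_act, hP] at h2
        exact ⟨y, rfl, h1, h2⟩
      · rintro ⟨y', h1, h2, h3⟩
        rw [h1, P.mem_carrier, P.mem_act, hP]
        exact ⟨h2, h3⟩
    · congr 1
      ext w
      refine exists_congr fun x => and_congr_left fun hw => and_congr_right fun _ => ?_
      exact (hv.mem_cutHyperplane_iff two_pos hs hw k).symm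
  · rw [lorentz_coordEquiv hv hr, lorentz_coordEquiv hv hr]
    congr 1
    have hrefl : ∀ u i, P.refl k u i = u i - P.form k u * P.vec k i := fun u i => by
      rw [MirrorPolytope.refl, Module.reflection_apply]
      simp
    have hmul : ∀ a a' i, (w i - a * P.vec k i) * (w' i - a' * P.vec k i) = w i * w' i -
        a * (P.vec k i * w' i) - a' * (P.vec k i * w i) + a * a' * (P.vec k i * P.vec k i) :=
      fun a a' i => by ring
    simp only [hrefl, hmul, Finset.sum_add_distrib, Finset.sum_sub_distrib, ← Finset.mul_sum]
    rcases k with j | j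
    · have hb : ∀ u : Vec 4, ∑ i, P.vec (Sum.inl j) i * u i = 2 * u j := fun u => by
        simp [hinl, Pi.single_apply]
      have hb1 : ∑ i, P.vec (Sum.inl j) i = 2 := by simpa using hb 1
      have hbj : P.vec (Sum.inl j) j = 2 := by simp [hinl]
      simp only [hb, hb1, hbj, hP, cutForm_inl, simplexMatrix_mulVec]
      ring
    · have hb : ∀ u : Vec 4, ∑ i, P.vec (Sum.inr j) i * u i = ∑ i, u i - 3 * u j := fun u => by
        have : ∀ i, P.vec (Sum.inr j) i * u i = u i - if i = j then 3 * u i else 0 := fun i => by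
          rcases eq_or_ne i j with h | h
          · simp [hinr, h]; ring
          · simp [hinr, h]
        simp_rw [this, Finset.sum_sub_distrib]
        simp
      have hb1 : ∑ i, P.vec (Sum.inr j) i = 2 := by
        have := hb 1
        simp at this
        rw [this]
        norm_num
      have hbj : P.vec (Sum.inr j) j = -2 := by simp [hinr]
      simp only [hb, hb1, hbj, hP, cutForm_inr]
      ring

/-! ### The functions `f`, `g_p`, `h` -/

theorem fFun_eq {t : ℝ} (ht : 0 < t) :
    fFun t = ((2 * (t + 1 / t) + 5) / (t + 1 / t + 1)) ^ 2 *
      ((2 * (t + 1 / t) + 5) / (t + 1 / t + 7) ^ 2) := by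
  have h1 : 0 < t ^ 2 + t + 1 := by positivity
  have h2 : 0 < t ^ 2 + 7 * t + 1 := by positivity
  have e1 : t + 1 / t + 1 = (t ^ 2 + t + 1) / t := by field_simp; ring
  have e2 : t + 1 / t + 7 = (t ^ 2 + 7 * t + 1) / t := by field_simp; ring
  have e3 : 2 * (t + 1 / t) + 5 = (t + 2) * (2 * t + 1) / t := by field_simp; ring
  rw [e1, e2, e3, fFun]
  field_simp

theorem two_le_add_one_div {t : ℝ} (ht : 0 < t) : 2 ≤ t + 1 / t := by
  have h : t + 1 / t - 2 = (t - 1) ^ 2 / t := by field_simp; ring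
  have : 0 ≤ (t - 1) ^ 2 / t := by positivity
  linarith

theorem add_one_div_lt {s t : ℝ} (hs : 0 < s) (hst : s < t) (ht : t ≤ 1) :
    t + 1 / t < s + 1 / s := by
  have ht0 : 0 < t := hs.trans hst
  have h : s + 1 / s - (t + 1 / t) = (t - s) * (1 - s * t) / (s * t) := by
    field_simp; ring
  have h1 : 0 < 1 - s * t := by nlinarith
  have h2 : 0 < t - s := by linarith
  have : 0 < (t - s) * (1 - s * t) / (s * t) := by positivity
  linarith

theorem fFun_strictMonoOn : StrictMonoOn fFun (Ioc 0 1) := by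
  intro s hs t ht hst
  rw [fFun_eq hs.1, fFun_eq ht.1]
  have hw := add_one_div_lt hs.1 hst ht.2
  have h2 := two_le_add_one_div ht.1
  set x := t + 1 / t
  set y := s + 1 / s
  have h3 : (2 * y + 5) / (y + 1) < (2 * x + 5) / (x + 1) := by
    rw [div_lt_div_iff₀ (by linarith) (by linarith)]
    linarith
  have h4 : (2 * y + 5) / (y + 7) ^ 2 ≤ (2 * x + 5) / (x + 7) ^ 2 := by
    rw [div_le_div_iff₀ (by nlinarith) (by nlinarith)]
    have : 0 ≤ (y - x) * (2 * x * y + 5 * (x + y) - 28) :=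
      mul_nonneg (by linarith) (by nlinarith)
    linarith
  have h5 : 0 < (2 * y + 5) / (y + 1) := div_pos (by linarith) (by linarith)
  have h6 : 0 < (2 * x + 5) / (x + 7) ^ 2 := div_pos (by linarith) (by nlinarith)
  calc _ ≤ ((2 * y + 5) / (y + 1)) ^ 2 * ((2 * x + 5) / (x + 7) ^ 2) := by gcongr
    _ < _ := by gcongr

theorem fFun_pos {t : ℝ} (ht : 0 < t) : 0 < fFun t := by
  unfold fFun; positivity

theorem fFun_one : fFun 1 = 1 := by norm_num [fFun]

theorem sq_sqrt_thirtyOne : √(31 + 22 * √2) ^ 2 = 31 + 22 * √2 := sq_sqrt (by positivity)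

theorem tThree_pos : 0 < tThree := by
  have h2 : √2 ^ 2 = 2 := sq_sqrt (by norm_num)
  have h := sq_sqrt_thirtyOne
  have h0 : 0 ≤ √2 := sqrt_nonneg _
  have : 3 * √(31 + 22 * √2) < 11 + 9 * √2 := by
    refine lt_of_pow_lt_pow_left₀ 2 (by positivity) ?_
    nlinarith
  unfold tThree
  linarith

theorem tThree_add_one_div : tThree + 1 / tThree = 11 + 9 * √2 := by
  have h2 : √2 ^ 2 = 2 := sq_sqrt (by norm_num)
  have h := sq_sqrt_thirtyOne
  have h0 := tThree_pos
  have : tThree ^ 2 + 1 = (11 + 9 * √2) * tThree := by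
    unfold tThree
    linear_combination 9 / 4 * h - 81 / 4 * h2
  field_simp
  linarith

theorem tThree_lt_one : tThree < 1 := by
  by_contra! h
  have h2 : √2 ^ 2 = 2 := sq_sqrt (by norm_num)
  have h0 : 0 ≤ √2 := sqrt_nonneg _
  have h1 := sq_sqrt_thirtyOne
  have : 11 + 9 * √2 - 2 < 3 * √(31 + 22 * √2) := by
    refine lt_of_pow_lt_pow_left₀ 2 (by positivity) ?_
    nlinarith
  unfold tThree at h
  linarith

theorem fFun_tThree : fFun tThree = 1 / 4 := by
  have h2 : √2 ^ 2 = 2 := sq_sqrt (by norm_num)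
  have h0 : 0 ≤ √2 := sqrt_nonneg _
  rw [fFun_eq tThree_pos, tThree_add_one_div, div_pow, div_mul_div_comm,
    div_eq_div_iff (by positivity) (by norm_num)]
  have e1 : 2 * (11 + 9 * √2) + 5 = 9 * (1 + √2) ^ 2 := by linear_combination -9 * h2
  have e2 : (11 + 9 * √2 + 1) * (11 + 9 * √2 + 7) = 54 * (1 + √2) ^ 3 := by
    linear_combination (81 - 162 - 54 * √2) * h2
  rw [e1, ← mul_pow, e2]
  ring

theorem pos_of_mem_Icc {t : ℝ} (ht : t ∈ Icc tThree 1) : 0 < t := tThree_pos.trans_le ht.1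

theorem fFun_mem_Icc {t : ℝ} (ht : t ∈ Icc tThree 1) : fFun t ∈ Icc (1 / 4) 1 := by
  have h := fFun_strictMonoOn.monotoneOn
  have ht0 := pos_of_mem_Icc ht
  constructor
  · rw [← fFun_tThree]
    exact h ⟨tThree_pos, tThree_lt_one.le⟩ ⟨ht0, ht.2⟩ ht.1
  · rw [← fFun_one]
    exact h ⟨ht0, ht.2⟩ ⟨one_pos, le_rfl⟩ ht.2

/-! ### The angle -/

/-- The quotient of `1 - f` by `(1 - t)²`. -/
def angleFactor (t : ℝ) : ℝ :=
  ((t + 1 / t) ^ 3 + 10 * (t + 1 / t) ^ 2 + 38 * (t + 1 / t) + 38) /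
    (t * ((t + 1 / t + 1) * (t + 1 / t + 7)) ^ 2)

theorem angleFactor_pos {t : ℝ} (ht : 0 < t) : 0 < angleFactor t := by
  unfold angleFactor; positivity

theorem one_sub_fFun {t : ℝ} (ht : 0 < t) : 1 - fFun t = (1 - t) ^ 2 * angleFactor t := by
  have hw := two_le_add_one_div ht
  have e : (1 - t) ^ 2 / t = t + 1 / t - 2 := by field_simp; ring
  have e' : (1 - t) ^ 2 * angleFactor t = (t + 1 / t - 2) *
      (((t + 1 / t) ^ 3 + 10 * (t + 1 / t) ^ 2 + 38 * (t + 1 / t) + 38) /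
        (((t + 1 / t + 1) * (t + 1 / t + 7)) ^ 2)) := by
    rw [← e, angleFactor]
    field_simp
  rw [fFun_eq ht, e']
  generalize t + 1 / t = w at hw
  have h1 : w + 1 ≠ 0 := by linarith
  have h2 : w + 7 ≠ 0 := by linarith
  field_simp
  ring

/-- The dihedral angle at the filling ridges. -/
def angle (t : ℝ) : ℝ := arcsin ((1 - t) * √(angleFactor t))

theorem mul_sqrt_angleFactor {t : ℝ} (ht : 0 < t) (ht1 : t ≤ 1) :
    (1 - t) * √(angleFactor t) = √(1 - fFun t) := by
  rw [one_sub_fFun ht, sqrt_mul (sq_nonneg _), sqrt_sq (by linarith)]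

theorem angle_eq {t : ℝ} (ht : 0 < t) (ht1 : t ≤ 1) : angle t = arcsin √(1 - fFun t) := by
  rw [angle, mul_sqrt_angleFactor ht ht1]

theorem sqrt_one_sub_fFun_mem {t : ℝ} (ht : t ∈ Icc tThree 1) : √(1 - fFun t) ∈ Ico 0 1 := by
  refine ⟨sqrt_nonneg _, ?_⟩
  rw [sqrt_lt' one_pos]
  linarith [fFun_pos (pos_of_mem_Icc ht)]

theorem analyticAt_angle {t : ℝ} (ht : t ∈ Icc tThree 1) : AnalyticAt ℝ angle t := by
  have ht0 := pos_of_mem_Icc ht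
  have hq : AnalyticAt ℝ angleFactor t := by
    unfold angleFactor
    have h1 : AnalyticAt ℝ (fun t : ℝ => 1 / t) t :=
      analyticAt_const.div analyticAt_id ht0.ne'
    have h2 : AnalyticAt ℝ (fun t : ℝ => t) t := analyticAt_id
    refine AnalyticAt.div (by fun_prop) (by fun_prop) ?_
    positivity
  have hs : AnalyticAt ℝ (fun t => √(angleFactor t)) t :=
    (contDiffAt_sqrt (angleFactor_pos ht0).ne').analyticAt.fun_comp hq
  have h := sqrt_one_sub_fFun_mem ht
  rw [← mul_sqrt_angleFactor ht0 ht.2] at h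
  have harc : AnalyticAt ℝ arcsin ((1 - t) * √(angleFactor t)) :=
    (contDiffAt_arcsin (by linarith [h.1]) h.2.ne).analyticAt
  have hmul : AnalyticAt ℝ (fun t => (1 - t) * √(angleFactor t)) t :=
    (analyticAt_const.sub analyticAt_id).mul hs
  exact AnalyticAt.comp (f := fun t => (1 - t) * √(angleFactor t)) harc hmul

theorem cos_angle_sq {t : ℝ} (ht : t ∈ Icc tThree 1) : cos (angle t) ^ 2 = fFun t := by
  have h := sqrt_one_sub_fFun_mem ht
  rw [cos_sq', angle_eq (pos_of_mem_Icc ht) ht.2, sin_arcsin (by linarith [h.1]) h.2.le,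
    sq_sqrt (by linarith [(fFun_mem_Icc ht).2])]
  ring

theorem angle_strictAntiOn : StrictAntiOn angle (Icc tThree 1) := by
  intro s hs t ht hst
  rw [angle_eq (pos_of_mem_Icc hs) hs.2, angle_eq (pos_of_mem_Icc ht) ht.2]
  have h1 := sqrt_one_sub_fFun_mem hs
  have h2 := sqrt_one_sub_fFun_mem ht
  refine strictMonoOn_arcsin ⟨by linarith [h2.1], h2.2.le⟩ ⟨by linarith [h1.1], h1.2.le⟩ ?_
  refine sqrt_lt_sqrt (by linarith [(fFun_mem_Icc ht).2]) ?_
  linarith [fFun_strictMonoOn ⟨pos_of_mem_Icc hs, hs.2⟩ ⟨pos_of_mem_Icc ht, ht.2⟩ hst]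

theorem angle_tThree : angle tThree = π / 3 := by
  rw [angle_eq tThree_pos tThree_lt_one.le, fFun_tThree,
    show √(1 - 1 / 4) = sin (π / 3) by
      rw [sin_pi_div_three, show (1 - 1 / 4 : ℝ) = (√3 / 2) ^ 2 by
        rw [div_pow, sq_sqrt (by norm_num)]; norm_num, sqrt_sq (by positivity)]]
  exact arcsin_sin (by linarith [pi_pos]) (by linarith [pi_pos])

theorem angle_one : angle 1 = 0 := by simp [angle]

/-! ### The blocks of the Cartan matrix -/

/-- The block of `C_t` indexed by the facets `F'_i`. -/
def upperBlock (t : ℝ) : Matrix (Fin 5) (Fin 5) ℝ := (cMatrix t).toBlocks₁₁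

/-- The block of `C_t` indexed by the facets `F_i`. -/
def lowerBlock (t : ℝ) : Matrix (Fin 5) (Fin 5) ℝ := (cMatrix t).toBlocks₂₂

theorem cMatrix_eq (t : ℝ) : cMatrix t = Matrix.fromBlocks (upperBlock t)
    (Matrix.diagonal fun _ => -hFun t) (Matrix.diagonal fun _ => -2) (lowerBlock t) := rfl

theorem cMatrix_inl_inl (t : ℝ) (i j : Fin 5) :
    cMatrix t (Sum.inl i) (Sum.inl j) = upperBlock t i j := rfl

theorem cMatrix_inl_inr (t : ℝ) (i j : Fin 5) :
    cMatrix t (Sum.inl i) (Sum.inr j) = if i = j then -hFun t else 0 := by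
  rw [cMatrix_eq, Matrix.fromBlocks_apply₁₂, Matrix.diagonal_apply]

theorem cMatrix_inr_inl (t : ℝ) (i j : Fin 5) :
    cMatrix t (Sum.inr i) (Sum.inl j) = if i = j then -2 else 0 := by
  rw [cMatrix_eq, Matrix.fromBlocks_apply₂₁, Matrix.diagonal_apply]

theorem cMatrix_inr_inr (t : ℝ) (i j : Fin 5) :
    cMatrix t (Sum.inr i) (Sum.inr j) = lowerBlock t i j := rfl

/-- The entries of the upper block below the diagonal, up to diagonal conjugation. -/
def lowFactor (t : ℝ) : ℝ :=
  2 * (2 * t + 1) ^ 4 / ((t ^ 2 + t + 1) * (t ^ 2 + 7 * t + 1) * (t * (t + 2)))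

/-- The entries of the upper block above the diagonal, up to diagonal conjugation. -/
def highFactor (t : ℝ) : ℝ :=
  2 * t ^ 2 * (t + 2) ^ 4 / ((t ^ 2 + t + 1) * (t ^ 2 + 7 * t + 1) * (2 * t + 1))

/-- The ratio of successive functions `g_p`. -/
def gRatio (t : ℝ) : ℝ := t * (t + 2) / (2 * t + 1)

theorem upperBlock_apply {t : ℝ} (ht : 0 < t) (i j : Fin 5) : upperBlock t i j =
    if i = j then 2 else
      -((if i < j then highFactor t else lowFactor t) *
        (gRatio t ^ (i : ℕ) / gRatio t ^ (j : ℕ))) := by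
  have h1 : t ^ 2 + t + 1 ≠ 0 := by positivity
  have h2 : t ^ 2 + 7 * t + 1 ≠ 0 := by positivity
  have h3 : 2 * t + 1 ≠ 0 := by positivity
  have h4 : t + 2 ≠ 0 := by positivity
  fin_cases i <;> fin_cases j <;>
    simp [upperBlock, cMatrix, gBarFun, gFun, fFun, highFactor, lowFactor, gRatio,
      Matrix.toBlocks₁₁] <;> field_simp <;> norm_num

theorem lowerBlock_apply (t : ℝ) (i j : Fin 5) : lowerBlock t i j =
    if i = j then 2 else if i < j then -(1 / t) else -t := by
  fin_cases i <;> fin_cases j <;> simp [lowerBlock, cMatrix, Matrix.toBlocks₂₂]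

theorem upperBlock_mul_lowerBlock {t : ℝ} (ht : 0 < t) :
    upperBlock t * lowerBlock t = Matrix.diagonal fun _ => 2 * hFun t := by
  have h1 : t ^ 2 + t + 1 ≠ 0 := by positivity
  have h2 : t ^ 2 + 7 * t + 1 ≠ 0 := by positivity
  have h3 : 2 * t + 1 ≠ 0 := by positivity
  have h4 : t + 2 ≠ 0 := by positivity
  ext i j
  fin_cases i <;> fin_cases j <;>
    simp [Matrix.mul_apply, Fin.sum_univ_five, upperBlock_apply ht, lowerBlock_apply, highFactor,
      lowFactor, gRatio, hFun] <;> field_simp <;> ring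

/-! ### Properties of the Cartan matrix -/

section Conjugate

variable {M : Matrix (Fin 5) (Fin 5) ℝ} {A B : ℝ} {ρ : Fin 5 → ℝ}

theorem mul_apply_eq_of_conj (hρ : ∀ i, 0 < ρ i)
    (hM : ∀ i j, M i j = if i = j then 2 else -((if i < j then A else B) * (ρ i / ρ j)))
    {i j : Fin 5} (hij : i ≠ j) : M i j * M j i = A * B := by
  have hi := (hρ i).ne'
  have hj := (hρ j).ne'
  rw [hM i j, hM j i, if_neg hij, if_neg hij.symm]
  rcases lt_or_gt_of_ne hij with h | h
  · rw [if_pos h, if_neg h.le.not_gt]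
    field_simp
  · rw [if_pos h, if_neg h.le.not_gt]
    field_simp

theorem isTripleNegative_of_conj (hρ : ∀ i, 0 < ρ i)
    (hM : ∀ i j, M i j = if i = j then 2 else -((if i < j then A else B) * (ρ i / ρ j)))
    (hA : 0 < A) (hB : 0 < B) (hAB : A * B ≤ 4) (hdet : 8 - 6 * (A * B) - A * B * (A + B) < 0) :
    IsTripleNegative M where
  diag i := by rw [hM, if_pos rfl]
  neg i j hij := by
    have := div_pos (hρ i) (hρ j)
    rw [hM, if_neg hij]
    split_ifs
    · linarith [mul_pos hA this]
    · linarith [mul_pos hB this]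
  mul_le i j hij := by rwa [mul_apply_eq_of_conj hρ hM hij]
  minor_neg i j k hij hik hjk := by
    have hi := (hρ i).ne'
    have hj := (hρ j).ne'
    have hk := (hρ k).ne'
    rw [mul_apply_eq_of_conj hρ hM hij, mul_apply_eq_of_conj hρ hM hik,
      mul_apply_eq_of_conj hρ hM hjk]
    have h1 : M i j * M j k * M k i = -((if i < j then A else B) * (if j < k then A else B) *
        (if k < i then A else B)) := by
      rw [hM i j, hM j k, hM k i, if_neg hij, if_neg hjk, if_neg hik.symm]
      field_simp
    have h2 : M i k * M k j * M j i = -((if i < k then A else B) * (if k < j then A else B) *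
        (if j < i then A else B)) := by
      rw [hM i k, hM k j, hM j i, if_neg hik, if_neg hjk.symm, if_neg hij.symm]
      field_simp
    have h3 : M i j * M j k * M k i + M i k * M k j * M j i = -(A * B * (A + B)) := by
      rw [h1, h2]
      rcases lt_or_gt_of_ne hij with h | h <;> rcases lt_or_gt_of_ne hik with h' | h' <;>
        rcases lt_or_gt_of_ne hjk with h'' | h'' <;>
        simp only [h, h', h'', h.le.not_gt, h'.le.not_gt, h''.le.not_gt, if_true, if_false] <;>
        first
          | exact absurd (h.trans h'') h'.le.not_gt
          | exact absurd (h''.trans h) h'.le.not_gt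
          | ring
    linarith

end Conjugate

section Blocks

variable {t : ℝ}

theorem highFactor_pos (ht : 0 < t) : 0 < highFactor t := by unfold highFactor; positivity

theorem gRatio_pos (ht : 0 < t) : 0 < gRatio t := by unfold gRatio; positivity

theorem hFun_pos (ht : 0 < t) : 0 < hFun t := by unfold hFun; positivity

theorem highFactor_mul_lowFactor (ht : 0 < t) : highFactor t * lowFactor t = 4 * fFun t := by
  unfold highFactor lowFactor fFun
  field_simp
  ring

theorem two_le_lowFactor (ht : 0 < t) (ht1 : t ≤ 1) : 2 ≤ lowFactor t := by
  unfold lowFactor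
  rw [le_div_iff₀ (by positivity)]
  have h4 : t ^ 4 ≤ 1 := pow_le_one₀ ht.le ht1
  have h5 : t ^ 5 ≤ t := by nlinarith
  have h6 : t ^ 6 ≤ t ^ 2 := by nlinarith [pow_pos ht 2]
  have h7 : t ^ 5 ≤ t ^ 3 := by nlinarith [pow_pos ht 3, pow_le_one₀ ht.le ht1 (n := 2)]
  have h8 : t ^ 4 ≤ t ^ 2 := by nlinarith [pow_pos ht 2, pow_le_one₀ ht.le ht1 (n := 2)]
  have h9 : t ^ 4 ≤ t ^ 3 := by nlinarith [pow_pos ht 3]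
  have h10 : t ^ 5 ≤ t ^ 2 := by nlinarith [pow_pos ht 2, pow_le_one₀ ht.le ht1 (n := 3)]
  nlinarith

theorem upperBlock_mul_apply (ht : 0 < t) {i j : Fin 5} (hij : i ≠ j) :
    upperBlock t i j * upperBlock t j i = 4 * fFun t := by
  rw [← highFactor_mul_lowFactor ht]
  exact mul_apply_eq_of_conj (fun i => pow_pos (gRatio_pos ht) i) (upperBlock_apply ht) hij

theorem isTripleNegative_upperBlock (ht : t ∈ Icc tThree 1) : IsTripleNegative (upperBlock t) := by
  have ht0 := pos_of_mem_Icc ht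
  have hf := fFun_mem_Icc ht
  have hA := highFactor_pos ht0
  have hB := two_le_lowFactor ht0 ht.2
  refine isTripleNegative_of_conj (fun i => pow_pos (gRatio_pos ht0) i) (upperBlock_apply ht0)
    hA (by linarith) ?_ ?_
  · rw [highFactor_mul_lowFactor ht0]
    linarith [hf.2]
  · rw [highFactor_mul_lowFactor ht0]
    nlinarith [hf.1]

theorem cMatrix_neg_or_zero (ht : t ∈ Icc tThree 1) (s s' : FacetIdx) (hs : s ≠ s') :
    (cMatrix t s s' < 0 ∧ cMatrix t s' s < 0) ∨ (cMatrix t s s' = 0 ∧ cMatrix t s' s = 0) := by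
  have ht0 := pos_of_mem_Icc ht
  have hM := isTripleNegative_upperBlock ht
  have hh := hFun_pos ht0
  rcases s with i | i <;> rcases s' with j | j
  · have hij : i ≠ j := fun h => hs (by rw [h])
    rw [cMatrix_inl_inl, cMatrix_inl_inl]
    exact Or.inl ⟨hM.neg i j hij, hM.neg j i hij.symm⟩
  · rw [cMatrix_inl_inr, cMatrix_inr_inl]
    rcases eq_or_ne i j with rfl | h
    · left; simpa using hh
    · right; simp [h, h.symm]
  · rw [cMatrix_inl_inr, cMatrix_inr_inl]
    rcases eq_or_ne i j with rfl | h
    · left; simpa using hh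
    · right; simp [h, h.symm]
  · have hij : i ≠ j := fun h => hs (by rw [h])
    have hneg : ∀ i j, i ≠ j → lowerBlock t i j < 0 := fun i j h => by
      rw [lowerBlock_apply, if_neg h]
      have := one_div_pos.2 ht0
      split_ifs <;> linarith
    rw [cMatrix_inr_inr, cMatrix_inr_inr]
    exact Or.inl ⟨hneg i j hij, hneg j i hij.symm⟩

theorem cMatrix_diag (ht : t ∈ Icc tThree 1) (s : FacetIdx) : cMatrix t s s = 2 := by
  rcases s with i | i
  · rw [cMatrix_inl_inl, (isTripleNegative_upperBlock ht).diag]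
  · rw [cMatrix_inr_inr, lowerBlock_apply, if_pos rfl]

theorem isCartanMatrix_cMatrix (ht : t ∈ Icc tThree 1) : IsCartanMatrix (cMatrix t) := by
  refine ⟨cMatrix_diag ht, fun s s' h => ?_, fun s s' h => ?_⟩
  · rcases cMatrix_neg_or_zero ht s s' h with h | h
    · exact h.1.le
    · exact h.1.le
  · rcases cMatrix_neg_or_zero ht s s' h with h | h
    · exact iff_of_false h.1.ne h.2.ne
    · exact iff_of_true h.1 h.2

theorem isIndecomposable_cMatrix (ht : t ∈ Icc tThree 1) : IsIndecomposable (cMatrix t) := by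
  rintro ⟨T, ⟨s, hs⟩, ⟨s', hs'⟩, h⟩
  have hM := isTripleNegative_upperBlock ht
  have h1 : ∀ i, (Sum.inr i ∈ T ↔ Sum.inl i ∈ T) := fun i => by
    have hne : cMatrix t (Sum.inr i) (Sum.inl i) ≠ 0 := by simp [cMatrix_inr_inl]
    constructor
    · intro hr
      by_contra hl
      exact hne (h _ hr _ hl).1
    · intro hl
      by_contra hr
      exact hne (h _ hl _ hr).2
  have h2 : ∀ i j, Sum.inl i ∈ T → Sum.inl j ∈ T := fun i j hi => by
    rcases eq_or_ne i j with rfl | hij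
    · exact hi
    by_contra hj
    refine (hM.neg i j hij).ne ?_
    rw [← cMatrix_inl_inl]
    exact (h _ hi _ hj).1
  obtain ⟨i, hi⟩ : ∃ i, Sum.inl i ∈ T := by
    rcases s with i | i
    · exact ⟨i, hs⟩
    · exact ⟨i, (h1 i).1 hs⟩
  rcases s' with j | j
  · exact hs' (h2 i j hi)
  · exact hs' ((h1 j).2 (h2 i j hi))

theorem eq_zero_of_vecMul_neg {S : Type} [Fintype S] {C : Matrix S S ℝ} {w x : S → ℝ}
    (hw : ∀ i, 0 < w i) (hwC : ∀ i, C.vecMul w i < 0) (hCx : ∀ i, 0 ≤ C.mulVec x i)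
    (hx : ∀ i, 0 ≤ x i) : x = 0 := by
  have h1 : 0 ≤ dotProduct w (C.mulVec x) :=
    Finset.sum_nonneg fun i _ => mul_nonneg (hw i).le (hCx i)
  rw [Matrix.dotProduct_mulVec] at h1
  have h2 : ∀ i ∈ Finset.univ, C.vecMul w i * x i ≤ 0 := fun i _ =>
    mul_nonpos_of_nonpos_of_nonneg (hwC i).le (hx i)
  have h3 := (Finset.sum_eq_zero_iff_of_nonpos h2).1 (le_antisymm (Finset.sum_nonpos h2) h1)
  funext i
  exact (mul_eq_zero.1 (h3 i (Finset.mem_univ i))).resolve_left (hwC i).ne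

theorem isNegativeType_cMatrix (ht : t ∈ Icc tThree 1) : IsNegativeType (cMatrix t) := by
  have ht0 := pos_of_mem_Icc ht
  have hM := isTripleNegative_upperBlock ht
  have hh := hFun_pos ht0
  rw [cMatrix_eq]
  constructor
  · obtain ⟨y, hy, hMy⟩ := hM.exists_pos_mulVec_neg (by simp)
    obtain ⟨δ, hδ, hle⟩ := exists_pos_forall_add_mul_nonpos (fun i => -y i)
      (fun i => (lowerBlock t).mulVec 1 i) (fun i => by linarith [hy i])
      (fun i hi => by linarith [hy i])
    refine ⟨Sum.elim y (δ • 1), ?_, ?_⟩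
    · rintro (i | i)
      · exact hy i
      · simpa using hδ
    · rintro (i | i)
      · have := hMy i
        have := mul_pos hh hδ
        simp [Matrix.fromBlocks_mulVec, Function.comp_def]
        linarith
      · have := hle i
        have := hy i
        rw [Matrix.fromBlocks_mulVec]
        simp only [Sum.elim_comp_inl, Sum.elim_comp_inr, Sum.elim_inr, Pi.add_apply,
          Matrix.mulVec_diagonal, Matrix.mulVec_smul, Pi.smul_apply, smul_eq_mul]
        linarith
  · obtain ⟨w, hw, hMw⟩ := hM.transpose.exists_pos_mulVec_neg (by simp)
    obtain ⟨δ, hδ, hle⟩ := exists_pos_forall_add_mul_nonpos (fun i => -(hFun t * w i) / 2)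
      (fun i => (lowerBlock t).vecMul 1 i) (fun i => by linarith [mul_pos hh (hw i)])
      (fun i hi => by linarith [mul_pos hh (hw i)])
    intro x hCx hx
    refine eq_zero_of_vecMul_neg (w := Sum.elim w (δ • 1)) ?_ ?_ hCx hx
    · rintro (i | i)
      · exact hw i
      · simpa using hδ
    · rintro (i | i)
      · have := hMw i
        rw [Matrix.mulVec_transpose] at this
        simp [Matrix.vecMul_fromBlocks, Function.comp_def]
        linarith
      · have := hle i
        have := mul_pos hh (hw i)
        rw [Matrix.vecMul_fromBlocks]
        simp only [Sum.elim_comp_inl, Sum.elim_comp_inr, Sum.elim_inr, Pi.add_apply,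
          Matrix.vecMul_diagonal, Matrix.smul_vecMul, Pi.smul_apply, smul_eq_mul]
        linarith

/-- The vectors `b_s`, in coordinates for which the forms of the facets `F_i` are the negatives of
the coordinate functions. -/
def mirrorVec (t : ℝ) : FacetIdx → Vec 4 :=
  Sum.elim (fun j => Pi.single j 2) (fun j i => -lowerBlock t i j)

theorem cutForm_mirrorVec (ht : 0 < t) (s s' : FacetIdx) :
    cutForm (upperBlock t) s (mirrorVec t s') = cMatrix t s s' := by
  rcases s with i | i <;> rcases s' with j | j
  · rw [cutForm_inl, cMatrix_inl_inl]
    simp [mirrorVec, Matrix.mulVec_single]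
    ring
  · have h := congrFun (congrFun (upperBlock_mul_lowerBlock ht) i) j
    rw [Matrix.mul_apply, Matrix.diagonal_apply] at h
    rw [cutForm_inl, cMatrix_inl_inr]
    simp only [mirrorVec, Sum.elim_inr, Matrix.mulVec, dotProduct, mul_neg,
      Finset.sum_neg_distrib]
    rw [show ∑ k, upperBlock t i k * lowerBlock t k j = _ from h]
    split_ifs <;> ring
  · rw [cutForm_inr, cMatrix_inr_inl]
    simp only [mirrorVec, Sum.elim_inl, Pi.single_apply]
    split_ifs <;> simp
  · rw [cutForm_inr, cMatrix_inr_inr]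
    simp [mirrorVec]

theorem rank_cMatrix (ht : 0 < t) : (cMatrix t).rank = 5 := by
  apply le_antisymm
  · have h : cMatrix t = (Matrix.of fun s k => cutForm (upperBlock t) s (Pi.single k 1)) *
        (Matrix.of fun (k : Fin 5) s => mirrorVec t s k) := by
      ext s s'
      rw [← cutForm_mirrorVec ht, Matrix.mul_apply,
        LinearMap.pi_apply_eq_sum_univ (cutForm (upperBlock t) s) (mirrorVec t s')]
      refine Finset.sum_congr rfl fun k _ => ?_
      rw [smul_eq_mul, mul_comm, Matrix.of_apply, Matrix.of_apply]
      congr 2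
      funext l
      simp [Pi.single_apply, eq_comm]
    rw [h]
    refine (Matrix.rank_mul_le_left _ _).trans ?_
    simpa using Matrix.rank_le_card_width
      (Matrix.of fun s (k : Fin 5) => cutForm (upperBlock t) s (Pi.single k 1))
  · have h : (cMatrix t).submatrix Sum.inr Sum.inl = Matrix.diagonal fun _ : Fin 5 => (-2 : ℝ) := by
      ext i j
      rw [Matrix.submatrix_apply, cMatrix_inr_inl, Matrix.diagonal_apply]
    have h1 := Matrix.rank_submatrix_le (cMatrix t) (Sum.inr : Fin 5 → FacetIdx)
      (Sum.inl : Fin 5 → FacetIdx)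
    rw [h, Matrix.rank_of_isUnit _ (by
      rw [Matrix.isUnit_iff_isUnit_det, Matrix.det_diagonal]; simp)] at h1
    simpa using h1

theorem analyticOn_cMatrix (s s' : FacetIdx) :
    AnalyticOn ℝ (fun t => cMatrix t s s') (Icc tThree 1) := by
  have hinv : ∀ t ∈ Icc tThree 1, AnalyticAt ℝ (fun t : ℝ => 1 / t) t := fun t ht =>
    analyticAt_const.div analyticAt_id (pos_of_mem_Icc ht).ne'
  have hid : ∀ t, AnalyticAt ℝ (fun t : ℝ => t) t := fun _ => analyticAt_id
  rcases s with i | i <;> rcases s' with j | j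
  · refine AnalyticOn.congr (f := fun t => if i = j then 2 else
      -((if i < j then highFactor t else lowFactor t) *
        (gRatio t ^ (i : ℕ) / gRatio t ^ (j : ℕ)))) ?_
      (fun t ht => by
        rw [cMatrix_inl_inl, upperBlock_apply (pos_of_mem_Icc ht)])
    intro t ht
    have ht0 := pos_of_mem_Icc ht
    have hr : AnalyticAt ℝ gRatio t := by
      unfold gRatio
      exact AnalyticAt.div (by fun_prop) (by fun_prop) (by positivity)
    have hA : AnalyticAt ℝ highFactor t := by
      unfold highFactor
      exact AnalyticAt.div (by fun_prop) (by fun_prop) (by positivity)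
    have hB : AnalyticAt ℝ lowFactor t := by
      unfold lowFactor
      exact AnalyticAt.div (by fun_prop) (by fun_prop) (by positivity)
    have hq : AnalyticAt ℝ (fun t => gRatio t ^ (i : ℕ) / gRatio t ^ (j : ℕ)) t :=
      AnalyticAt.div (hr.pow _) (hr.pow _) (pow_pos (gRatio_pos ht0) _).ne'
    refine AnalyticAt.analyticWithinAt ?_
    split_ifs
    · exact analyticAt_const
    · exact (hA.mul hq).neg
    · exact (hB.mul hq).neg
  · intro t ht
    have ht0 := pos_of_mem_Icc ht
    have hh : AnalyticAt ℝ hFun t := by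
      unfold hFun
      have := hinv t ht
      exact AnalyticAt.add (by fun_prop)
        (AnalyticAt.div (by fun_prop) (by fun_prop) (by positivity))
    refine AnalyticAt.analyticWithinAt ?_
    simp only [cMatrix_inl_inr]
    split_ifs
    · exact hh.neg
    · exact analyticAt_const
  · simp only [cMatrix_inr_inl]
    exact analyticOn_const
  · intro t ht
    refine AnalyticAt.analyticWithinAt ?_
    simp only [cMatrix_inr_inr, lowerBlock_apply]
    split_ifs
    · exact analyticAt_const
    · exact (hinv t ht).neg
    · exact (hid t).neg

end Blocks

/-! ### The path of mirror polytopes -/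

/-- The mirror polytope with Cartan matrix `C_t`. -/
def mirrorPolytope (t : Icc tThree 1) : MirrorPolytope 4 FacetIdx :=
  MirrorPolytope.ofCartan (cutForm (upperBlock t)) (mirrorVec t)
    (fun s => by rw [cutForm_mirrorVec (pos_of_mem_Icc t.2), cMatrix_diag t.2])
    (fun s s' h => by
      rw [cutForm_mirrorVec (pos_of_mem_Icc t.2), cutForm_mirrorVec (pos_of_mem_Icc t.2)]
      exact cMatrix_neg_or_zero t.2 s s' h)
    (fun v hv => funext fun i => by simpa using hv (Sum.inr i))
    ((isTripleNegative_upperBlock t.2).exists_cutForm_neg (by simp))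

theorem mirrorPolytope_form (t : Icc tThree 1) :
    (mirrorPolytope t).form = cutForm (upperBlock t) := rfl

theorem mirrorPolytope_vec (t : Icc tThree 1) : (mirrorPolytope t).vec = mirrorVec t := rfl

theorem cartan_mirrorPolytope (t : Icc tThree 1) : (mirrorPolytope t).cartan = cMatrix t := by
  ext s s'
  exact cutForm_mirrorVec (pos_of_mem_Icc t.2) s s'

theorem continuous_mirrorPolytope : Continuous mirrorPolytope := by
  have hC : ∀ s s', Continuous fun t : Icc tThree 1 => cMatrix t s s' := fun s s' =>
    (analyticOn_cMatrix s s').continuousOn.comp_continuous continuous_subtype_val fun t => t.2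
  have hU : ∀ i j, Continuous fun t : Icc tThree 1 => upperBlock t i j := fun i j =>
    hC (Sum.inl i) (Sum.inl j)
  have hL : ∀ i j, Continuous fun t : Icc tThree 1 => lowerBlock t i j := fun i j =>
    hC (Sum.inr i) (Sum.inr j)
  rw [continuous_induced_rng]
  refine Continuous.prodMk ?_ ?_
  · refine continuous_pi fun s => continuous_pi fun v => ?_
    simp only [mirrorPolytope_form]
    rcases s with i | i
    · simp only [cutForm_inl, Matrix.mulVec, dotProduct]
      exact continuous_const.mul (continuous_finsetSum _ fun j _ => (hU i j).mul continuous_const)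
    · simp only [cutForm_inr]
      exact continuous_const
  · refine continuous_pi fun s => ?_
    simp only [mirrorPolytope_vec]
    rcases s with j | j
    · exact continuous_const
    · exact continuous_pi fun i => (hL i j).neg

theorem isBitruncatedActive_pair_inl (i j : Fin 5) :
    IsBitruncatedActive {Sum.inl i, Sum.inl j} := by
  refine ⟨by simp, ?_, by simp⟩
  simp only [mem_insert_iff, mem_singleton_iff, Sum.inl.injEq]
  grind

theorem isBitruncatedActive_pair_inr (i j : Fin 5) :
    IsBitruncatedActive {Sum.inr i, Sum.inr j} := by
  refine ⟨by simp, by simp, ?_⟩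
  simp only [mem_insert_iff, mem_singleton_iff, Sum.inr.injEq]
  grind

theorem isBitruncatedActive_pair_inr_inl {i j : Fin 5} (hij : i ≠ j) :
    IsBitruncatedActive {Sum.inr i, Sum.inl j} := by
  refine ⟨?_, ?_, ?_⟩ <;>
    simp only [mem_insert_iff, mem_singleton_iff, Sum.inr.injEq, Sum.inl.injEq, reduceCtorEq,
      or_false, false_or] <;> grind

theorem hasDihedralAngle_of_form_eq (P : MirrorPolytope 4 FacetIdx)
    {M : Matrix (Fin 5) (Fin 5) ℝ} (hP : P.form = cutForm M) (hM : IsTripleNegative M)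
    (hlt : ∀ i j, i ≠ j → M i j * M j i < 4) {s s' : FacetIdx} (hs : s ≠ s')
    (hJ : IsBitruncatedActive {s, s'}) {θ : ℝ} (hθ : 0 < θ) (hθ' : θ ≤ π / 2)
    (h : P.form s (P.vec s') * P.form s' (P.vec s) = 4 * cos θ ^ 2) :
    HasDihedralAngle P s s' θ := by
  constructor
  · obtain ⟨y, hy0, hy1, hy2⟩ := hM.exists_active hlt hJ
    rw [← hP] at hy1 hy2
    refine P.isRidge_facet_inter hy0 (hy1 s (by simp)) (hy1 s' (by simp))
      (fun u h1 h2 => hy2 u (by simp [h1, h2])) ?_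
    have hsin := sin_pos_of_pos_of_lt_pi hθ (by linarith [pi_pos])
    have := sin_sq_add_cos_sq θ
    rw [h]
    nlinarith
  · refine Or.inl ⟨hθ, hθ', isProjRotation_reflection_comp (P.form_vec s) (P.form_vec s') ?_
      hθ hθ' h⟩
    rcases P.neg_or_zero s s' hs with h | h
    · exact iff_of_false h.1.ne h.2.ne
    · exact iff_of_true h.1 h.2

theorem isIdealHyperbolicRectifiedSimplex_mirrorPolytope (t : Icc tThree 1) (ht : (t : ℝ) = 1) :
    IsIdealHyperbolicRectifiedSimplex (mirrorPolytope t) := by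
  refine isIdealHyperbolicRectifiedSimplex_of_form_eq _ ?_ (fun j => rfl) (fun j => ?_)
  · rw [mirrorPolytope_form, ht]
    congr 1
    ext i j
    rw [upperBlock_apply one_pos]
    norm_num [simplexMatrix, highFactor, lowFactor, gRatio]
  · funext i
    rw [mirrorPolytope_vec, ht]
    simp only [mirrorVec, Sum.elim_inr, lowerBlock_apply]
    split_ifs <;> norm_num

theorem exists_angle_eq {x : ℝ} (hx : x ∈ Icc 0 (π / 3)) : ∃ t ∈ Icc tThree 1, angle t = x := by
  have hcont : ContinuousOn angle (Icc tThree 1) := fun t ht =>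
    (analyticAt_angle ht).continuousAt.continuousWithinAt
  have h := intermediate_value_Icc' tThree_lt_one.le hcont
  rw [angle_one, angle_tThree] at h
  exact h hx

theorem angle_mem_Icc {t : ℝ} (ht : t ∈ Icc tThree 1) : angle t ∈ Icc 0 (π / 3) := by
  have h := angle_strictAntiOn.antitoneOn
  rw [← angle_one, ← angle_tThree]
  exact ⟨h ht ⟨tThree_lt_one.le, le_rfl⟩ ht.2, h ⟨le_rfl, tThree_lt_one.le⟩ ht ht.1⟩

/-- The angle, as a homeomorphism onto its image. -/
def angleHomeomorph : Icc tThree 1 ≃ₜ Icc (0 : ℝ) (π / 3) :=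
  Continuous.homeoOfEquivCompactToT2
    (f := Equiv.ofBijective (fun t : Icc tThree 1 => (⟨angle t, angle_mem_Icc t.2⟩ : Icc 0 (π / 3)))
      ⟨fun s t h => Subtype.ext (angle_strictAntiOn.injOn s.2 t.2 (Subtype.mk.inj h)),
        fun x => by
          obtain ⟨t, ht, h⟩ := exists_angle_eq x.2
          exact ⟨⟨t, ht⟩, Subtype.ext h⟩⟩)
    (Continuous.subtype_mk (continuous_iff_continuousAt.2 fun t =>
      (analyticAt_angle t.2).continuousAt.comp continuousAt_subtype_val) _)

theorem coe_angleHomeomorph (t : Icc tThree 1) : (angleHomeomorph t : ℝ) = angle t := rfl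

/-- The parameter at which the angle takes a given value. -/
def angleInv (α : ℝ) : Icc tThree 1 :=
  angleHomeomorph.symm (projIcc 0 (π / 3) (by positivity) α)

theorem continuous_angleInv : Continuous angleInv :=
  angleHomeomorph.symm.continuous.comp continuous_projIcc

theorem angle_angleInv {α : ℝ} (hα : α ∈ Icc 0 (π / 3)) : angle (angleInv α) = α := by
  rw [← coe_angleHomeomorph, angleInv, Homeomorph.apply_symm_apply, projIcc_of_mem _ hα]

theorem angleInv_angle (t : Icc tThree 1) : angleInv (angle t) = t := by
  rw [angleInv, projIcc_of_mem _ (angle_mem_Icc t.2)]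
  exact angleHomeomorph.symm_apply_apply t

end

theorem mainTheorem2 :
    (∀ t ∈ Set.Icc tThree 1,
      IsCartanMatrix (cMatrix t) ∧ IsIndecomposable (cMatrix t) ∧
        IsNegativeType (cMatrix t) ∧ (cMatrix t).rank = 5) ∧
    (∀ s s', AnalyticOn ℝ (fun t => cMatrix t s s') (Set.Icc tThree 1)) ∧
    ∃ (a : ℝ → ℝ) (P : ℝ → MirrorPolytope 4 FacetIdx),
      -- the angle as a function of the parameter
      AnalyticOn ℝ a (Set.Icc tThree 1) ∧ StrictAntiOn a (Set.Icc tThree 1) ∧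
      a tThree = Real.pi / 3 ∧ a 1 = 0 ∧
      (∀ t ∈ Set.Icc tThree 1, Real.cos (a t) ^ 2 = fFun t) ∧
      -- the path of mirror polytopes, including its limit at angle zero
      ContinuousOn P (Set.Icc 0 (Real.pi / 3)) ∧
      (∀ t ∈ Set.Icc tThree 1, (P (a t)).cartan = cMatrix t) ∧
      -- combinatorics and dihedral angles
      (∀ α ∈ Set.Ioc 0 (Real.pi / 3),
        IsCombBitruncatedSimplex (P α) ∧
        ∀ i j : Fin 5, i ≠ j →
          HasDihedralAngle (P α) (Sum.inl i) (Sum.inl j) α ∧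
          HasDihedralAngle (P α) (Sum.inr i) (Sum.inl j) (Real.pi / 2) ∧
          HasDihedralAngle (P α) (Sum.inr i) (Sum.inr j) (Real.pi / 3)) ∧
      -- the limit polytope
      IsIdealHyperbolicRectifiedSimplex (P 0) := by
  refine ⟨fun t ht => ⟨isCartanMatrix_cMatrix ht, isIndecomposable_cMatrix ht,
    isNegativeType_cMatrix ht, rank_cMatrix (pos_of_mem_Icc ht)⟩, analyticOn_cMatrix,
    angle, fun α => mirrorPolytope (angleInv α),
    fun t ht => (analyticAt_angle ht).analyticWithinAt, angle_strictAntiOn, angle_tThree,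
    angle_one, fun t ht => cos_angle_sq ht,
    (continuous_mirrorPolytope.comp continuous_angleInv).continuousOn, fun t ht => ?_,
    fun α hα => ?_, ?_⟩
  · change (mirrorPolytope (angleInv (angle t))).cartan = cMatrix t
    rw [show angleInv (angle t) = ⟨t, ht⟩ from angleInv_angle ⟨t, ht⟩]
    exact cartan_mirrorPolytope ⟨t, ht⟩
  · have hpi := Real.pi_pos
    have hang := angle_angleInv (Set.Ioc_subset_Icc_self hα)
    set t := angleInv α
    have ht0 := pos_of_mem_Icc t.2
    have hM := isTripleNegative_upperBlock t.2
    have hf := cos_angle_sq t.2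
    rw [hang] at hf
    have hsin := sin_pos_of_pos_of_lt_pi hα.1 (by linarith [hα.2])
    have hsc := sin_sq_add_cos_sq α
    have hlt : ∀ i j, i ≠ j → upperBlock t i j * upperBlock t j i < 4 := fun i j hij => by
      rw [upperBlock_mul_apply ht0 hij, ← hf]
      nlinarith
    have hC : ∀ s s', (mirrorPolytope t).form s ((mirrorPolytope t).vec s') = cMatrix t s s' :=
      cutForm_mirrorVec ht0
    refine ⟨isCombBitruncatedSimplex_of_form_eq _ rfl hM hlt, fun i j hij => ⟨?_, ?_, ?_⟩⟩
    · refine hasDihedralAngle_of_form_eq _ rfl hM hlt (by simpa using hij)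
        (isBitruncatedActive_pair_inl i j) hα.1 (by linarith [hα.2]) ?_
      rw [hC, hC, cMatrix_inl_inl, cMatrix_inl_inl, upperBlock_mul_apply ht0 hij, hf]
    · refine hasDihedralAngle_of_form_eq _ rfl hM hlt (by simp)
        (isBitruncatedActive_pair_inr_inl hij) (by linarith) le_rfl ?_
      rw [hC, hC, cMatrix_inr_inl, if_neg hij, cos_pi_div_two]
      ring
    · refine hasDihedralAngle_of_form_eq _ rfl hM hlt (by simpa using hij)
        (isBitruncatedActive_pair_inr i j) (by linarith) (by linarith) ?_
      have hne : (t : ℝ) ≠ 0 := ht0.ne'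
      rw [hC, hC, cMatrix_inr_inr, cMatrix_inr_inr, lowerBlock_apply, lowerBlock_apply,
        if_neg hij, if_neg hij.symm, cos_pi_div_three]
      rcases lt_or_gt_of_ne hij with h | h
      · rw [if_pos h, if_neg h.le.not_gt]
        field_simp
        norm_num
      · rw [if_pos h, if_neg h.le.not_gt]
        field_simp
        norm_num
  · refine isIdealHyperbolicRectifiedSimplex_mirrorPolytope _ ?_
    have h := angleInv_angle ⟨1, tThree_lt_one.le, le_rfl⟩
    simp only [angle_one] at h
    rw [h]
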